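/- Fix a field $k$ and, for $n\ge 1$, give $\mathbb{R}^n$ the coordinatewise partial order. An $\mathbb{R}^n$-module is a functor $M$ from the poset $\mathbb{R}^n$ to $k$-vector spaces; no finite-dimensionality is assumed. For $\epsilon\ge 0$ let $M(\epsilon)$ be the shifted module, $M(\epsilon)_p=M_{p+(\epsilon,\dots,\epsilon)}$, and let $\phi_{M,\epsilon}\colon M\to M(\epsilon)$ be given by the internal maps of $M$. Modules $M,N$ are $\epsilon$-interleaved if there are morphisms $f\colon M\to N(\epsilon)$, $g\colon N\to M(\epsilon)$ with $g(\epsilon)\circ f=\phi_{M,2\epsilon}$ and $f(\epsilon)\circ g=\phi_{N,2\epsilon}$; $M$ is $\epsilon$-trivial if $\phi_{M,\epsilon}=0$. Put $d_I(M,N)=\inf\{\epsilon\ge 0 : M,N \text{ are } \epsilon\text{-interleaved}\}\in[0,\infty]$. An interval is a nonempty subset $I\subseteq\mathbb{R}^n$ that is order-convex ($p\le r\le q$ and $p,q\in I$ imply $r\in I$) and in which any two points are joined by a finite zigzag $p\le p_1\ge p_2\le\dots\ge p_{2m}\le q$ of points of $I$. Its interval module $\mathbb{I}^I$ is $k$ at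 the points of $I$ and $0$ elsewhere, with identity internal maps between points of $I$. A module $M$ is interval decomposable if $M\cong\bigoplus_{I\in B(M)}\mathbb{I}^I$ for a multiset $B(M)$ of intervals, its barcode (which is then unique). A rectangle is an interval of the form $R_1\times\dots\times R_n$ with $R_i\subseteq\mathbb{R}$, and $M$ is rectangle decomposable if it is interval decomposable and all members of $B(M)$ are rectangles. Interval decomposable modules $M,N$ are $\epsilon$-matched if there is a bijection $\sigma$ from a sub-multiset of $B(M)$ to a sub-multiset of $B(N)$ such that $\mathbb{I}^I$ and $\mathbb{I}^{\sigma(I)}$ are $\epsilon$-interleaved whenever $\sigma(I)$ is defined and $\mathbb{I}^I$ is $2\epsilon$-trivial for every unmatched $I$ in $B(M)$ or $B(N)$. Put $d_B(M,N)=\inf\{\epsilon\ge 0 : M,N\text{ are }\epsilon\text{-matched}\}\in[0,\infty]$. Then, for every $n\ge 1$ and all rectangle decomposable $\mathbb{R}^n$-modules $M$ and $N$, $$d_B(M,N)\le (2n-1)\,d_I(M,N).$$ Moreover, for $n=1$ the isometry theorem holds for all interval decomposable $\mathbb{R}$-modules $M$ and $N$: $d_B(M,N)=d_I(M,N)$.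 -/

import Mathlib

universe u v

namespace Persistence

open CategoryTheory
open scoped NNReal ENNReal DirectSum

noncomputable section

/-- A persistence module over the poset `P`: a functor from `P` to vector spaces over `k`. No
finiteness of dimension is required. -/
abbrev PersistenceModule (k : Type u) [Field k] (P : Type) [PartialOrder P] :=
  P ⥤ ModuleCat.{v} k

/-- The internal morphism `M p → M q` of a persistence module for `p ≤ q`. -/
def internal {k : Type u} [Field k] {P : Type} [PartialOrder P] (M : PersistenceModule.{u, v} k P)
    {p q : P} (h : p ≤ q) : M.obj p ⟶ M.obj q :=
  M.map (homOfLE h)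

/-- An interval of a poset: a nonempty, order-convex subset in which any two points `p`, `q` are
joined by a zigzag `p = s 0 ≤ s 1 ≥ s 2 ≤ s 3 ≥ ⋯ ≥ s (2 * m) ≤ s (2 * m + 1) = q`. -/
structure PInterval (P : Type) [PartialOrder P] where
  carrier : Set P
  nonempty : carrier.Nonempty
  ordConnected : carrier.OrdConnected
  zigzag : ∀ p ∈ carrier, ∀ q ∈ carrier, ∃ (m : ℕ) (s : ℕ → P),
    s 0 = p ∧ s (2 * m + 1) = q ∧ (∀ i ≤ 2 * m + 1, s i ∈ carrier) ∧
    (∀ i ≤ m, s (2 * i) ≤ s (2 * i + 1)) ∧ (∀ i < m, s (2 * i + 2) ≤ s (2 * i + 1))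

/-- The space of the interval module at `p`: all of `k` if `p ∈ I`, and `0` otherwise. -/
def intervalSpace (k : Type u) [Field k] {P : Type} [PartialOrder P] (I : PInterval P) (p : P) :
    Submodule k k where
  carrier := {x | p ∉ I.carrier → x = 0}
  zero_mem' := fun _ => rfl
  add_mem' := fun ha hb h => by rw [ha h, hb h, add_zero]
  smul_mem' := fun c x hx h => by rw [hx h, smul_zero]

open Classical in
/-- The map of the interval module from `p` to `q`: the identity of `k` if `p, q ∈ I`, and zero
otherwise. (If `p ∉ I`, the source is zero.) -/
def intervalMap (k : Type u) [Field k] {P : Type} [PartialOrder P] (I : PInterval P) (p q : P) :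
    intervalSpace k I p →ₗ[k] intervalSpace k I q where
  toFun x := ⟨if q ∈ I.carrier then (x : k) else 0, fun h => if_neg h⟩
  map_add' x y := by
    ext
    by_cases h : q ∈ I.carrier <;> simp [h]
  map_smul' c x := by
    ext
    by_cases h : q ∈ I.carrier <;> simp [h]

/-- The interval module of the interval `I`. -/
def intervalModule (k : Type u) [Field k] {P : Type} [PartialOrder P] (I : PInterval P) :
    PersistenceModule.{u, u} k P where
  obj p := ModuleCat.of k (intervalSpace k I p)
  map {p q} _ := ModuleCat.ofHom (intervalMap k I p q)
  map_id p := by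
    refine ModuleCat.hom_ext (LinearMap.ext fun x => Subtype.ext ?_)
    by_cases h : p ∈ I.carrier
    · simp [intervalMap, h]
    · simpa [intervalMap, h] using (x.2 h).symm
  map_comp {p q r} f g := by
    refine ModuleCat.hom_ext (LinearMap.ext fun x => Subtype.ext ?_)
    by_cases hr : r ∈ I.carrier
    · by_cases hq : q ∈ I.carrier
      · simp [intervalMap, hr, hq]
      · have hp : p ∉ I.carrier := fun hp =>
          hq (I.ordConnected.out hp hr ⟨leOfHom f, leOfHom g⟩)
        simpa [intervalMap, hr, hq] using x.2 hp
    · simp [intervalMap, hr]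

/-- The family `B`, regarded as a multiset of intervals, is a barcode of `M`: there is an
isomorphism from `M` to the direct sum of the interval modules of the `B i`, that is, a family of
linear isomorphisms `e p` commuting with the internal maps. -/
def IsBarcode {k : Type u} [Field k] {P : Type} [PartialOrder P]
    (M : PersistenceModule.{u, v} k P) {ι : Type v} (B : ι → PInterval P) : Prop :=
  ∃ e : ∀ p : P, M.obj p ≃ₗ[k] ⨁ i, intervalSpace k (B i) p,
    ∀ (p q : P) (h : p ≤ q) (x : M.obj p) (i : ι),
      e q (internal M h x) i = intervalMap k (B i) p q (e p x i)

/-- `M` is interval decomposable: it has a barcode. -/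
def IntervalDecomposable {k : Type u} [Field k] {P : Type} [PartialOrder P]
    (M : PersistenceModule.{u, v} k P) : Prop :=
  ∃ (ι : Type v) (B : ι → PInterval P), IsBarcode M B

/-- The poset `ℝⁿ` with the coordinatewise order. It is a type synonym, so that its category
structure is unambiguously the one given by the order. -/
def Rn (n : ℕ) : Type := Fin n → ℝ

instance (n : ℕ) : PartialOrder (Rn n) := inferInstanceAs (PartialOrder (Fin n → ℝ))

/-- The translation `p ↦ p + (ε, …, ε)` of `ℝⁿ`. -/
def translate {n : ℕ} (ε : ℝ≥0) (p : Rn n) : Rn n := fun i => p i + ε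

lemma translate_mono {n : ℕ} (ε : ℝ≥0) : Monotone (translate (n := n) ε) :=
  fun _ _ h i => add_le_add_left (h i) _

lemma le_translate_translate {n : ℕ} (ε : ℝ≥0) (p : Rn n) :
    p ≤ translate ε (translate ε p) := fun i => by
  have h : (0 : ℝ) ≤ ε := ε.2
  simp only [translate]
  linarith

/-- The shift `M(ε)` of an `ℝⁿ`-module: `M(ε) p = M (p + ε)`. -/
def shift {k : Type u} [Field k] {n : ℕ} (ε : ℝ≥0) (M : PersistenceModule.{u, v} k (Rn n)) :
    PersistenceModule.{u, v} k (Rn n) :=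
  (translate_mono ε).functor ⋙ M

/-- `M` and `N` are `ε`-interleaved: there are morphisms `f : M → N(ε)` and `g : N → M(ε)` with
`g(ε) ∘ f` and `f(ε) ∘ g` equal to the internal morphisms `M → M(2ε)` and `N → N(2ε)`; the point
`p + 2ε` is written `translate ε (translate ε p)`. -/
def Interleaved {k : Type u} [Field k] {n : ℕ} (ε : ℝ≥0)
    (M N : PersistenceModule.{u, v} k (Rn n)) : Prop :=
  ∃ (f : M ⟶ shift ε N) (g : N ⟶ shift ε M),
    (∀ p, f.app p ≫ g.app (translate ε p) = internal M (le_translate_translate ε p)) ∧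
    (∀ p, g.app p ≫ f.app (translate ε p) = internal N (le_translate_translate ε p))

/-- `M` is `2ε`-trivial: all internal morphisms `M p → M (p + 2ε)` vanish. -/
def TwiceTrivial {k : Type u} [Field k] {n : ℕ} (ε : ℝ≥0)
    (M : PersistenceModule.{u, v} k (Rn n)) : Prop :=
  ∀ p, internal M (le_translate_translate ε p) = 0

/-- An `ε`-matching between two multisets (indexed families) of intervals: a partial bijection
leaving only `2ε`-trivial intervals unmatched and matching only `ε`-interleaved ones. -/
structure IsMatching (k : Type u) [Field k] {n : ℕ} (ε : ℝ≥0) {ι κ : Type v}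
    (B : ι → PInterval (Rn n)) (C : κ → PInterval (Rn n)) (σ : ι ≃. κ) : Prop where
  left : ∀ i, σ i = none → TwiceTrivial ε (intervalModule k (B i))
  right : ∀ j, σ.symm j = none → TwiceTrivial ε (intervalModule k (C j))
  matched : ∀ i j, σ i = some j →
    Interleaved ε (intervalModule k (B i)) (intervalModule k (C j))

/-- `M` and `N` are `ε`-matched: they are interval decomposable and their barcodes admit an
`ε`-matching. A barcode is unique up to reindexing; this is required of all ways to write it. -/
def Matched {k : Type u} [Field k] {n : ℕ} (ε : ℝ≥0)
    (M N : PersistenceModule.{u, v} k (Rn n)) : Prop :=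
  IntervalDecomposable M ∧ IntervalDecomposable N ∧
    ∀ (ι κ : Type v) (B : ι → PInterval (Rn n)) (C : κ → PInterval (Rn n)),
      IsBarcode M B → IsBarcode N C → ∃ σ : ι ≃. κ, IsMatching k ε B C σ

/-- The interleaving distance (`∞` if there is no interleaving). -/
def interleavingDist {k : Type u} [Field k] {n : ℕ}
    (M N : PersistenceModule.{u, v} k (Rn n)) : ℝ≥0∞ :=
  ⨅ (ε : ℝ≥0) (_ : Interleaved ε M N), (ε : ℝ≥0∞)

/-- The bottleneck distance (`∞` if there is no matching). -/
def bottleneckDist {k : Type u} [Field k] {n : ℕ}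
    (M N : PersistenceModule.{u, v} k (Rn n)) : ℝ≥0∞ :=
  ⨅ (ε : ℝ≥0) (_ : Matched ε M N), (ε : ℝ≥0∞)

/-- A rectangle: an interval of `ℝⁿ` of the form `R₁ × ⋯ × Rₙ`. -/
def IsRectangle {n : ℕ} (I : PInterval (Rn n)) : Prop :=
  ∃ R : Fin n → Set ℝ, I.carrier = {p | ∀ i, p i ∈ R i}

/-- `M` is rectangle decomposable: it has a barcode consisting of rectangles. -/
def RectangleDecomposable {k : Type u} [Field k] {n : ℕ}
    (M : PersistenceModule.{u, v} k (Rn n)) : Prop :=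
  ∃ (ι : Type v) (B : ι → PInterval (Rn n)), IsBarcode M B ∧ ∀ i, IsRectangle (B i)

end

end Persistence

namespace Persistence

open CategoryTheory
open scoped NNReal ENNReal DirectSum

noncomputable section

/-! ### Scalars attached to morphisms of direct sums of interval modules -/

/-! An interleaving between direct sums of interval modules is a pair of matrices of scalars whose
product in one order gives the components of the internal morphism. A morphism between two rectangle
modules is governed by a single scalar, its `homWeight`. If this is nonzero, every endpoint of the
target is at most the matching endpoint of the source plus ε. The order `alpha` measures the total
size of the 2n endpoints. If it does not decrease along a nonzero morphism, the 2n nonnegative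
slacks add up to at most 2nε, so all endpoints differ by at most (2n-1)ε. This is where the constant
comes from.

For a nonzero path I → J → K with `alpha` of K at least that of I, at least one of the two steps
does not decrease `alpha`, so J is close to I or to K. For a finite set A of long bars of M, the
entries of the product of weight matrices with `alpha` nondecreasing thus only involve bars of N
close to some bar in A. These entries form a unitriangular system, and linear independence of its
rows is Hall's condition (`IsScalarPair.card_le_card`).

Without finiteness assumptions a bar may have infinitely many close bars. Endpoints are rounded to a
grid of width η, which leaves countably many classes, each adjacent to finitely many. Bars with
finitely many neighbours are handled by Hall's theorem, the others by cardinal arithmetic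
(`exists_injective_of_locallyFinite`). The injections from both sides merge by a Cantor–Bernstein
argument (`exists_pequiv_of_injective`), and rectangles with close endpoints are interleaved. The
cost η disappears in the infimum.

The reverse inequality is the summandwise construction `IsMatching.interleaved`. For n = 1 every
interval is a rectangle and 2n-1 = 1, which gives the isometry. -/

/-- `c` describes a morphism from the interval module of `I` to that of `J`, reindexed along `τ`:
`c p` is the scalar by which the morphism acts at `p`. -/
structure IsHomScalar {k : Type u} [Field k] {P : Type} [PartialOrder P] (τ : P → P)
    (I J : Set P) (c : P → k) : Prop where
  mem_source : ∀ {p}, c p ≠ 0 → p ∈ I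
  mem_target : ∀ {p}, c p ≠ 0 → τ p ∈ J
  eq_of_le : ∀ {p q}, p ≤ q → p ∈ I → τ q ∈ J → c p = c q

section Scalars

variable {k : Type u} [Field k] {P : Type} [PartialOrder P]

open Classical in
/-- The generator of the interval module at `p` (zero if `p ∉ I`). -/
def intervalUnit (k : Type u) [Field k] (I : PInterval P) (p : P) : intervalSpace k I p :=
  ⟨if p ∈ I.carrier then 1 else 0, fun h => if_neg h⟩

lemma coe_intervalUnit_of_mem {I : PInterval P} {p : P} (h : p ∈ I.carrier) :
    (intervalUnit k I p : k) = 1 := if_pos h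

lemma intervalUnit_of_notMem {I : PInterval P} {p : P} (h : p ∉ I.carrier) :
    intervalUnit k I p = 0 := Subtype.ext (if_neg h)

lemma coe_smul_intervalUnit {I : PInterval P} {p : P} (x : intervalSpace k I p) :
    (x : k) • intervalUnit k I p = x := by
  by_cases h : p ∈ I.carrier
  · exact Subtype.ext (by simp [coe_intervalUnit_of_mem h])
  · exact Subtype.ext (by simp [intervalUnit_of_notMem h, x.2 h])

lemma coe_intervalMap_of_mem {I : PInterval P} {p q : P} (h : q ∈ I.carrier)
    (x : intervalSpace k I p) : (intervalMap k I p q x : k) = x := if_pos h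

lemma intervalMap_intervalUnit {I : PInterval P} {p q : P} (h : p ∈ I.carrier) :
    intervalMap k I p q (intervalUnit k I p) = intervalUnit k I q := by
  refine Subtype.ext ?_
  simp [intervalMap, intervalUnit, h]

variable {ι κ : Type v}

/-- The internal map from `p` to `q` of a direct sum of interval modules. -/
def sumMap (k : Type u) [Field k] (B : ι → PInterval P) (p q : P) :
    (⨁ i, intervalSpace k (B i) p) →ₗ[k] ⨁ i, intervalSpace k (B i) q :=
  DirectSum.lmap fun i => intervalMap k (B i) p q

lemma sumMap_apply (B : ι → PInterval P) (p q : P) (x : ⨁ i, intervalSpace k (B i) p) (i : ι) :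
    sumMap k B p q x i = intervalMap k (B i) p q (x i) :=
  DirectSum.lmap_apply _ _ _

open Classical in
lemma sumMap_lof (B : ι → PInterval P) (p q : P) (i : ι) (x : intervalSpace k (B i) p) :
    sumMap k B p q (DirectSum.lof k ι (fun i => intervalSpace k (B i) p) i x) =
      DirectSum.lof k ι (fun i => intervalSpace k (B i) q) i (intervalMap k (B i) p q x) :=
  DirectSum.lmap_lof _ _ _

open Classical in
/-- The scalar at `p` of the component from the `i`-th to the `j`-th summand. -/
def homScalar {τ : P → P} {B : ι → PInterval P} {C : κ → PInterval P}
    (F : ∀ p, (⨁ i, intervalSpace k (B i) p) →ₗ[k] ⨁ j, intervalSpace k (C j) (τ p))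
    (i : ι) (j : κ) (p : P) : k :=
  F p (DirectSum.lof k ι (fun i => intervalSpace k (B i) p) i (intervalUnit k (B i) p)) j

lemma isHomScalar_homScalar {τ : P → P} {B : ι → PInterval P} {C : κ → PInterval P}
    (F : ∀ p, (⨁ i, intervalSpace k (B i) p) →ₗ[k] ⨁ j, intervalSpace k (C j) (τ p))
    (hF : ∀ p q, p ≤ q → ∀ x, F q (sumMap k B p q x) = sumMap k C (τ p) (τ q) (F p x))
    (i : ι) (j : κ) : IsHomScalar τ (B i).carrier (C j).carrier (homScalar F i j) where
  mem_source {p} h := by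
    by_contra hp
    refine h ?_
    simp [homScalar, intervalUnit_of_notMem hp]
  mem_target {p} h := by
    by_contra hp
    exact h ((F p _ j).2 hp)
  eq_of_le {p q} hpq hp hq := by
    classical
    rw [homScalar, homScalar, ← intervalMap_intervalUnit (q := q) hp, ← sumMap_lof, hF p q hpq,
      sumMap_apply, coe_intervalMap_of_mem hq]

lemma finite_support_homScalar {τ : P → P} {B : ι → PInterval P} {C : κ → PInterval P}
    (F : ∀ p, (⨁ i, intervalSpace k (B i) p) →ₗ[k] ⨁ j, intervalSpace k (C j) (τ p))
    (i : ι) (p : P) : (Function.support fun j => homScalar F i j p).Finite := by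
  classical
  refine (DFinsupp.finite_support
    (F p (DirectSum.lof k ι (fun i => intervalSpace k (B i) p) i (intervalUnit k (B i) p)))).subset
      fun j hj => ?_
  intro h
  refine hj ?_
  exact congrArg Subtype.val h

/-- Expand the image of the generator at `p` in the generators of the target summands, apply `G`,
and read off coordinate `i'`. Any finite `t` containing the support is allowed, so that the index
set can be enlarged later. -/
lemma sum_homScalar_mul {τ : P → P} {B : ι → PInterval P} {C : κ → PInterval P}
    (F : ∀ p, (⨁ i, intervalSpace k (B i) p) →ₗ[k] ⨁ j, intervalSpace k (C j) (τ p))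
    (G : ∀ p, (⨁ j, intervalSpace k (C j) p) →ₗ[k] ⨁ i, intervalSpace k (B i) (τ p))
    (hGF : ∀ p x, G (τ p) (F p x) = sumMap k B p (τ (τ p)) x)
    {i i' : ι} {p : P} (hp : p ∈ (B i).carrier) (hp' : τ (τ p) ∈ (B i').carrier)
    [Decidable (i = i')]
    {t : Finset κ} (ht : ∀ j, homScalar F i j p ≠ 0 → j ∈ t) :
    ∑ j ∈ t, homScalar F i j p * homScalar G j i' (τ p) = if i = i' then 1 else 0 := by
  classical
  set y := F p (DirectSum.lof k ι (fun i => intervalSpace k (B i) p) i (intervalUnit k (B i) p))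
    with hy
  have hsum : y = ∑ j ∈ t, homScalar F i j p •
      DirectSum.lof k κ (fun j => intervalSpace k (C j) (τ p)) j (intervalUnit k (C j) (τ p)) := by
    refine DFinsupp.ext fun j => ?_
    have e1 : ∀ j, homScalar F i j p •
        DirectSum.lof k κ (fun j => intervalSpace k (C j) (τ p)) j (intervalUnit k (C j) (τ p)) =
        DirectSum.lof k κ (fun j => intervalSpace k (C j) (τ p)) j (y j) := fun j => by
      rw [← map_smul]
      congr 1
      exact coe_smul_intervalUnit (y j)
    simp_rw [e1]
    rw [DFinsupp.finsetSum_apply]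
    by_cases hj : j ∈ t
    · rw [Finset.sum_eq_single_of_mem j hj]
      · exact (DirectSum.lof_apply (M := fun j => intervalSpace k (C j) (τ p)) k j (y j)).symm
      · intro b _ hb
        exact DirectSum.of_eq_of_ne (β := fun j => intervalSpace k (C j) (τ p)) b j (y b) (Ne.symm hb)
    · rw [Finset.sum_eq_zero]
      · by_contra hne
        refine hj (ht j fun h => hne ?_)
        exact Subtype.ext h
      · intro b hbt
        exact DirectSum.of_eq_of_ne (β := fun j => intervalSpace k (C j) (τ p)) b j (y b)
          (fun h => hj (h ▸ hbt))
  have h1 := congrArg (fun z => (z i' : k)) (hGF p (DirectSum.lof k ι _ i (intervalUnit k (B i) p)))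
  simp only at h1
  rw [← hy, hsum, sumMap_lof, intervalMap_intervalUnit hp, map_sum] at h1
  have h2 : ∀ z : κ → ⨁ i, intervalSpace k (B i) (τ (τ p)),
      (((∑ j ∈ t, z j) i' : intervalSpace k (B i') (τ (τ p))) : k) = ∑ j ∈ t, (z j i' : k) := by
    intro z
    rw [DFinsupp.finsetSum_apply, Submodule.coe_sum]
  rw [h2] at h1
  have h3 : ∀ j, ((G (τ p) (homScalar F i j p • DirectSum.lof k κ
      (fun j => intervalSpace k (C j) (τ p)) j (intervalUnit k (C j) (τ p))) i' :
        intervalSpace k (B i') (τ (τ p))) : k) =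
      homScalar F i j p * homScalar G j i' (τ p) := by
    intro j
    rw [map_smul]
    rfl
  simp_rw [h3] at h1
  rw [h1]
  split_ifs with h
  · subst h
    rw [DirectSum.lof_apply, coe_intervalUnit_of_mem hp']
  · have := DirectSum.of_eq_of_ne (β := fun i => intervalSpace k (B i) (τ (τ p))) i i'
      (intervalUnit k (B i) (τ (τ p))) (Ne.symm h)
    exact congrArg Subtype.val this

/-- The scalars `a i j p` of a morphism between direct sums of interval modules (reindexed along
`τ`), together with those of a morphism `b` back, whose composite is the internal morphism. -/
structure IsScalarPair (τ : P → P) (B : ι → PInterval P) (C : κ → PInterval P)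
    (a : ι → κ → P → k) (b : κ → ι → P → k) : Prop where
  left : ∀ i j, IsHomScalar τ (B i).carrier (C j).carrier (a i j)
  right : ∀ j i, IsHomScalar τ (C j).carrier (B i).carrier (b j i)
  finite_left : ∀ i p, (Function.support fun j => a i j p).Finite
  finite_right : ∀ j p, (Function.support fun i => b j i p).Finite
  comp_self : ∀ {i p} {t : Finset κ}, p ∈ (B i).carrier → τ (τ p) ∈ (B i).carrier →
    (∀ j, a i j p ≠ 0 → j ∈ t) → ∑ j ∈ t, a i j p * b j i (τ p) = 1
  comp_of_ne : ∀ {i i' p} {t : Finset κ}, i ≠ i' → p ∈ (B i).carrier → τ (τ p) ∈ (B i').carrier →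
    (∀ j, a i j p ≠ 0 → j ∈ t) → ∑ j ∈ t, a i j p * b j i' (τ p) = 0

end Scalars

/-! ### Interleavings in terms of scalars -/

lemma Interleaved.symm {k : Type u} [Field k] {n : ℕ} {ε : ℝ≥0}
    {M N : PersistenceModule.{u, v} k (Rn n)} (h : Interleaved ε M N) : Interleaved ε N M :=
  let ⟨f, g, h₁, h₂⟩ := h
  ⟨g, f, h₂, h₁⟩

lemma interleaved_iff {k : Type u} [Field k] {n : ℕ} {ε : ℝ≥0}
    {M N : PersistenceModule.{u, v} k (Rn n)} :
    Interleaved ε M N ↔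
      ∃ (f : ∀ p, M.obj p →ₗ[k] N.obj (translate ε p))
        (g : ∀ p, N.obj p →ₗ[k] M.obj (translate ε p)),
        (∀ p q (h : p ≤ q) x,
          f q (internal M h x) = internal N (translate_mono ε h) (f p x)) ∧
        (∀ p q (h : p ≤ q) x,
          g q (internal N h x) = internal M (translate_mono ε h) (g p x)) ∧
        (∀ p x, g (translate ε p) (f p x) = internal M (le_translate_translate ε p) x) ∧
        (∀ p x, f (translate ε p) (g p x) = internal N (le_translate_translate ε p) x) := by
  constructor
  · rintro ⟨f, g, h₁, h₂⟩
    refine ⟨fun p => (f.app p).hom, fun p => (g.app p).hom, fun p q h x => ?_, fun p q h x => ?_,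
      fun p x => ?_, fun p x => ?_⟩
    · exact LinearMap.congr_fun (congrArg ModuleCat.Hom.hom (f.naturality (homOfLE h))) x
    · exact LinearMap.congr_fun (congrArg ModuleCat.Hom.hom (g.naturality (homOfLE h))) x
    · exact LinearMap.congr_fun (congrArg ModuleCat.Hom.hom (h₁ p)) x
    · exact LinearMap.congr_fun (congrArg ModuleCat.Hom.hom (h₂ p)) x
  · rintro ⟨f, g, hf, hg, h₁, h₂⟩
    refine ⟨⟨fun p => ModuleCat.ofHom (f p), fun p q h => ?_⟩,
      ⟨fun p => ModuleCat.ofHom (g p), fun p q h => ?_⟩, fun p => ?_, fun p => ?_⟩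
    · exact ModuleCat.hom_ext (LinearMap.ext fun x => hf p q (leOfHom h) x)
    · exact ModuleCat.hom_ext (LinearMap.ext fun x => hg p q (leOfHom h) x)
    · exact ModuleCat.hom_ext (LinearMap.ext fun x => h₁ p x)
    · exact ModuleCat.hom_ext (LinearMap.ext fun x => h₂ p x)

lemma IsBarcode.exists_equiv {k : Type u} [Field k] {P : Type} [PartialOrder P]
    {M : PersistenceModule.{u, v} k P} {ι : Type v} {B : ι → PInterval P} (hB : IsBarcode M B) :
    ∃ e : ∀ p : P, M.obj p ≃ₗ[k] ⨁ i, intervalSpace k (B i) p,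
      ∀ (p q : P) (h : p ≤ q) (x : M.obj p),
        e q (internal M h x) = sumMap k B p q (e p x) := by
  obtain ⟨e, he⟩ := hB
  refine ⟨e, fun p q h x => DFinsupp.ext fun i => ?_⟩
  rw [he]
  exact (sumMap_apply B p q (e p x) i).symm

lemma Interleaved.exists_isScalarPair {k : Type u} [Field k] {n : ℕ} {ε : ℝ≥0}
    {M N : PersistenceModule.{u, v} k (Rn n)} (h : Interleaved ε M N) {ι κ : Type v}
    {B : ι → PInterval (Rn n)} {C : κ → PInterval (Rn n)} (hB : IsBarcode M B)
    (hC : IsBarcode N C) :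
    ∃ (a : ι → κ → Rn n → k) (b : κ → ι → Rn n → k), IsScalarPair (translate ε) B C a b := by
  classical
  obtain ⟨f, g, nf, ng, h₁, -⟩ := interleaved_iff.1 h
  obtain ⟨eM, heM⟩ := hB.exists_equiv
  obtain ⟨eN, heN⟩ := hC.exists_equiv
  let F : ∀ p, (⨁ i, intervalSpace k (B i) p) →ₗ[k] ⨁ j, intervalSpace k (C j) (translate ε p) :=
    fun p => (eN (translate ε p)).toLinearMap ∘ₗ f p ∘ₗ (eM p).symm.toLinearMap
  let G : ∀ p, (⨁ j, intervalSpace k (C j) p) →ₗ[k] ⨁ i, intervalSpace k (B i) (translate ε p) :=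
    fun p => (eM (translate ε p)).toLinearMap ∘ₗ g p ∘ₗ (eN p).symm.toLinearMap
  have hF : ∀ p x, F p (eM p x) = eN (translate ε p) (f p x) := fun p x => by
    simp [F]
  have hG : ∀ p x, G p (eN p x) = eM (translate ε p) (g p x) := fun p x => by
    simp [G]
  have natF : ∀ p q, p ≤ q → ∀ x, F q (sumMap k B p q x) =
      sumMap k C (translate ε p) (translate ε q) (F p x) := by
    intro p q hpq x
    obtain ⟨x, rfl⟩ := (eM p).surjective x
    rw [← heM p q hpq, hF, hF, ← heN _ _ (translate_mono ε hpq), nf]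
  have natG : ∀ p q, p ≤ q → ∀ x, G q (sumMap k C p q x) =
      sumMap k B (translate ε p) (translate ε q) (G p x) := by
    intro p q hpq x
    obtain ⟨x, rfl⟩ := (eN p).surjective x
    rw [← heN p q hpq, hG, hG, ← heM _ _ (translate_mono ε hpq), ng]
  have hGF : ∀ p x, G (translate ε p) (F p x) = sumMap k B p (translate ε (translate ε p)) x := by
    intro p x
    obtain ⟨x, rfl⟩ := (eM p).surjective x
    rw [← heM p _ (le_translate_translate ε p), hF, hG, h₁]
  refine ⟨homScalar F, homScalar G, isHomScalar_homScalar F natF, isHomScalar_homScalar G natG,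
    finite_support_homScalar F, finite_support_homScalar G, ?_, ?_⟩
  · intro i p t hp hp' ht
    simpa using sum_homScalar_mul F G hGF hp hp' ht
  · intro i i' p t hne hp hp' ht
    simpa only [if_neg hne] using sum_homScalar_mul F G hGF hp hp' (i' := i') ht

/-! ### The bars of a barcode are determined by the module -/

lemma internal_internal {k : Type u} [Field k] {P : Type} [PartialOrder P]
    (M : PersistenceModule.{u, v} k P) {p q r : P} (h : p ≤ q) (h' : q ≤ r) (x : M.obj p) :
    internal M h' (internal M h x) = internal M (h.trans h') x :=
  (LinearMap.congr_fun (congrArg ModuleCat.Hom.hom (M.map_comp (homOfLE h) (homOfLE h'))) x).symm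

lemma translate_zero {n : ℕ} (p : Rn n) : translate 0 p = p :=
  funext fun i => by simp [translate]

/-- Used to compare two barcodes of the same module. Translation by 0 is not the identity by
definition, so internal maps along an equality of points take the place of identities. -/
lemma interleaved_zero_self {k : Type u} [Field k] {n : ℕ}
    (M : PersistenceModule.{u, v} k (Rn n)) : Interleaved 0 M M := by
  refine interleaved_iff.2 ⟨fun p => (internal M (translate_zero p).ge).hom,
    fun p => (internal M (translate_zero p).ge).hom, fun p q h x => ?_, fun p q h x => ?_,
    fun p x => ?_, fun p x => ?_⟩
  all_goals
    first
    | exact internal_internal M _ _ x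
    | exact (internal_internal M _ _ x).trans (internal_internal M _ _ x).symm

lemma PInterval.induction {P : Type} [PartialOrder P] (I : PInterval P) {Q : P → Prop} {p : P}
    (hp : p ∈ I.carrier) (h : Q p)
    (hle : ∀ {q r}, q ∈ I.carrier → r ∈ I.carrier → q ≤ r → Q q → Q r)
    (hge : ∀ {q r}, q ∈ I.carrier → r ∈ I.carrier → r ≤ q → Q q → Q r)
    {q : P} (hq : q ∈ I.carrier) : Q q := by
  obtain ⟨m, s, hs0, hsm, hmem, hup, hdown⟩ := I.zigzag p hp q hq
  have key : ∀ i ≤ 2 * m + 1, Q (s i) := by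
    intro i
    induction i with
    | zero => exact fun _ => hs0 ▸ h
    | succ i ih =>
      intro hi
      -- Steps of the zigzag from an even index go up, those from an odd index go down.
      obtain ⟨l, rfl | rfl⟩ := Nat.even_or_odd' i
      · exact hle (hmem _ (by omega)) (hmem _ hi) (hup l (by omega)) (ih (by omega))
      · exact hge (hmem _ (by omega)) (hmem _ hi) (hdown l (by omega)) (ih (by omega))
  exact hsm ▸ key _ le_rfl

/-- The two isomorphisms give mutually inverse scalar matrices, so for some `j` both `a i j` and `b
j i` are nonzero at a point. Joint nonvanishing propagates along zigzags, upwards and downwards, in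
either interval, so each contains the other. -/
lemma IsBarcode.exists_carrier_eq {k : Type u} [Field k] {n : ℕ}
    {M : PersistenceModule.{u, v} k (Rn n)} {ι κ : Type v} {B : ι → PInterval (Rn n)}
    {C : κ → PInterval (Rn n)} (hB : IsBarcode M B) (hC : IsBarcode M C) (i : ι) :
    ∃ j, (C j).carrier = (B i).carrier := by
  obtain ⟨a, b, h⟩ := (interleaved_zero_self M).exists_isScalarPair hB hC
  have hid : translate (n := n) 0 = id := funext translate_zero
  rw [hid] at h
  obtain ⟨p, hp⟩ := (B i).nonempty
  obtain ⟨j, -, hj⟩ : ∃ j ∈ (h.finite_left i p).toFinset, a i j p * b j i p ≠ 0 := by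
    refine Finset.exists_ne_zero_of_sum_ne_zero ?_
    have := h.comp_self (t := (h.finite_left i p).toFinset) hp hp (fun j hj => by simpa using hj)
    exact ne_of_eq_of_ne this one_ne_zero
  have ha := h.left i j
  have hb := h.right j i
  have hab : a i j p ≠ 0 ∧ b j i p ≠ 0 := mul_ne_zero_iff.1 hj
  refine ⟨j, Set.Subset.antisymm (fun q hq => ?_) fun q hq => ?_⟩
  · refine ha.mem_source (((C j).induction (Q := fun q => a i j q ≠ 0 ∧ b j i q ≠ 0)
      (ha.mem_target hab.1) hab ?_ ?_ hq).1)
    · rintro q r hq hr hqr ⟨h1, h2⟩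
      have h1' : a i j r ≠ 0 := ha.eq_of_le hqr (ha.mem_source h1) hr ▸ h1
      exact ⟨h1', hb.eq_of_le hqr hq (ha.mem_source h1') ▸ h2⟩
    · rintro q r hq hr hqr ⟨h1, h2⟩
      have h2' : b j i r ≠ 0 := (hb.eq_of_le hqr hr (ha.mem_source h1)).symm ▸ h2
      exact ⟨(ha.eq_of_le hqr (hb.mem_target h2') hq).symm ▸ h1, h2'⟩
  · refine ha.mem_target (((B i).induction (Q := fun q => a i j q ≠ 0 ∧ b j i q ≠ 0)
      hp hab ?_ ?_ hq).1)
    · rintro q r hq hr hqr ⟨h1, h2⟩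
      have h2' : b j i r ≠ 0 := hb.eq_of_le hqr (ha.mem_target h1) hr ▸ h2
      exact ⟨ha.eq_of_le hqr hq (hb.mem_source h2') ▸ h1, h2'⟩
    · rintro q r hq hr hqr ⟨h1, h2⟩
      have h1' : a i j r ≠ 0 := (ha.eq_of_le hqr hr (ha.mem_target h1)).symm ▸ h1
      exact ⟨h1', (hb.eq_of_le hqr (ha.mem_target h1') hq).symm ▸ h2⟩

/-- Needed because `Matched` quantifies over all barcodes, whereas the hypothesis provides just one
made of rectangles. -/
lemma RectangleDecomposable.isRectangle {k : Type u} [Field k] {n : ℕ}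
    {M : PersistenceModule.{u, v} k (Rn n)} (hM : RectangleDecomposable M) {ι : Type v}
    {B : ι → PInterval (Rn n)} (hB : IsBarcode M B) (i : ι) : IsRectangle (B i) := by
  obtain ⟨κ, C, hC, hR⟩ := hM
  obtain ⟨j, hj⟩ := hB.exists_carrier_eq hC i
  obtain ⟨R, h⟩ := hR j
  exact ⟨R, hj ▸ h⟩

lemma isRectangle_of_dim_one (I : PInterval (Rn 1)) : IsRectangle I := by
  refine ⟨fun _ => {x | (fun _ => x : Rn 1) ∈ I.carrier}, Set.ext fun p => ?_⟩
  have : ∀ i, (fun _ => p i : Rn 1) = p := fun i => funext fun j => by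
    rw [Subsingleton.elim i j]
  exact ⟨fun h i => (this i).symm ▸ h, fun h => this 0 ▸ h 0⟩

/-! ### Matchings give interleavings -/

section Matching

variable {k : Type u} [Field k] {n : ℕ} {ι κ : Type v} {B : ι → PInterval (Rn n)}
  {C : κ → PInterval (Rn n)} {ε : ℝ≥0}

open Classical in
/-- The morphism of direct sums given by a partial bijection `σ` between the summands and
morphisms `φ i j` for `σ i = some j`. -/
def matchMap (σ : ι ≃. κ) (p : Rn n)
    (φ : ∀ i j, intervalSpace k (B i) p →ₗ[k] intervalSpace k (C j) (translate ε p)) :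
    (⨁ i, intervalSpace k (B i) p) →ₗ[k] ⨁ j, intervalSpace k (C j) (translate ε p) :=
  DirectSum.toModule k ι _ fun i =>
    match σ i with
    | none => 0
    | some j => DirectSum.lof k κ (fun j => intervalSpace k (C j) (translate ε p)) j ∘ₗ φ i j

open Classical in
lemma matchMap_lof_of_none {σ : ι ≃. κ} {p : Rn n}
    (φ : ∀ i j, intervalSpace k (B i) p →ₗ[k] intervalSpace k (C j) (translate ε p)) {i : ι}
    (h : σ i = none) (x : intervalSpace k (B i) p) :
    matchMap σ p φ (DirectSum.lof k ι (fun i => intervalSpace k (B i) p) i x) = 0 := by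
  simp [matchMap, h]

open Classical in
lemma matchMap_lof_of_some {σ : ι ≃. κ} {p : Rn n}
    (φ : ∀ i j, intervalSpace k (B i) p →ₗ[k] intervalSpace k (C j) (translate ε p)) {i : ι}
    {j : κ} (h : σ i = some j) (x : intervalSpace k (B i) p) :
    matchMap σ p φ (DirectSum.lof k ι (fun i => intervalSpace k (B i) p) i x) =
      DirectSum.lof k κ (fun j => intervalSpace k (C j) (translate ε p)) j (φ i j x) := by
  simp [matchMap, h]

lemma matchMap_sumMap {σ : ι ≃. κ}
    (φ : ∀ i j p, intervalSpace k (B i) p →ₗ[k] intervalSpace k (C j) (translate ε p))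
    (hφ : ∀ i j, σ i = some j → ∀ p q, p ≤ q → ∀ x, φ i j q (intervalMap k (B i) p q x) =
      intervalMap k (C j) (translate ε p) (translate ε q) (φ i j p x))
    {p q : Rn n} (hpq : p ≤ q) (x : ⨁ i, intervalSpace k (B i) p) :
    matchMap σ q (fun i j => φ i j q) (sumMap k B p q x) =
      sumMap k C (translate ε p) (translate ε q) (matchMap σ p (fun i j => φ i j p) x) := by
  classical
  suffices h : matchMap σ q (fun i j => φ i j q) ∘ₗ sumMap k B p q =
      sumMap k C (translate ε p) (translate ε q) ∘ₗ matchMap σ p (fun i j => φ i j p) from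
    LinearMap.congr_fun h x
  refine DirectSum.linearMap_ext k fun i => LinearMap.ext fun x => ?_
  simp only [LinearMap.comp_apply, sumMap_lof]
  cases h : σ i with
  | none => rw [matchMap_lof_of_none _ h, matchMap_lof_of_none _ h, map_zero]
  | some j => rw [matchMap_lof_of_some _ h, matchMap_lof_of_some _ h, sumMap_lof, hφ i j h p q hpq]

lemma matchMap_matchMap {σ : ι ≃. κ}
    (φ : ∀ i j p, intervalSpace k (B i) p →ₗ[k] intervalSpace k (C j) (translate ε p))
    (ψ : ∀ j i p, intervalSpace k (C j) p →ₗ[k] intervalSpace k (B i) (translate ε p))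
    (h : ∀ i j, σ i = some j → ∀ p x, ψ j i (translate ε p) (φ i j p x) =
      intervalMap k (B i) p (translate ε (translate ε p)) x)
    (h0 : ∀ i, σ i = none → ∀ p x, intervalMap k (B i) p (translate ε (translate ε p)) x = 0)
    (p : Rn n) (x : ⨁ i, intervalSpace k (B i) p) :
    matchMap σ.symm (translate ε p) (fun j i => ψ j i (translate ε p))
      (matchMap σ p (fun i j => φ i j p) x) = sumMap k B p (translate ε (translate ε p)) x := by
  classical
  suffices h : matchMap σ.symm (translate ε p) (fun j i => ψ j i (translate ε p)) ∘ₗ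
      matchMap σ p (fun i j => φ i j p) = sumMap k B p (translate ε (translate ε p)) from
    LinearMap.congr_fun h x
  refine DirectSum.linearMap_ext k fun i => LinearMap.ext fun x => ?_
  simp only [LinearMap.comp_apply, sumMap_lof]
  cases hi : σ i with
  | none => rw [matchMap_lof_of_none _ hi, h0 i hi, map_zero, map_zero]
  | some j =>
    rw [matchMap_lof_of_some _ hi, matchMap_lof_of_some _ ((PEquiv.eq_some_iff σ).2 hi), h i j hi]

/-- Matched summands use their own interleaving and unmatched ones are sent to zero, which is
correct because their internal maps over 2ε vanish. -/
lemma IsMatching.interleaved {M N : PersistenceModule.{u, v} k (Rn n)} {σ : ι ≃. κ}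
    (hσ : IsMatching k ε B C σ) (hB : IsBarcode M B) (hC : IsBarcode N C) : Interleaved ε M N := by
  obtain ⟨eM, heM⟩ := hB.exists_equiv
  obtain ⟨eN, heN⟩ := hC.exists_equiv
  have key : ∀ i j, ∃ (φ : ∀ p, intervalSpace k (B i) p →ₗ[k] intervalSpace k (C j) (translate ε p))
      (ψ : ∀ p, intervalSpace k (C j) p →ₗ[k] intervalSpace k (B i) (translate ε p)),
      σ i = some j →
        (∀ p q, p ≤ q → ∀ x, φ q (intervalMap k (B i) p q x) =
          intervalMap k (C j) (translate ε p) (translate ε q) (φ p x)) ∧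
        (∀ p q, p ≤ q → ∀ x, ψ q (intervalMap k (C j) p q x) =
          intervalMap k (B i) (translate ε p) (translate ε q) (ψ p x)) ∧
        (∀ p x, ψ (translate ε p) (φ p x) =
          intervalMap k (B i) p (translate ε (translate ε p)) x) ∧
        (∀ p x, φ (translate ε p) (ψ p x) =
          intervalMap k (C j) p (translate ε (translate ε p)) x) := by
    intro i j
    by_cases hij : σ i = some j
    · obtain ⟨f, g, h⟩ := interleaved_iff.1 (hσ.matched i j hij)
      exact ⟨f, g, fun _ => h⟩
    -- For unmatched pairs the zero maps are mere placeholders, so that the choice can be made for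
    -- all `i` and `j`.
    · exact ⟨0, 0, fun h => absurd h hij⟩
  choose φ ψ hφψ using key
  have hleft : ∀ i, σ i = none →
      ∀ p x, intervalMap k (B i) p (translate ε (translate ε p)) x = 0 := fun i hi p x =>
    LinearMap.congr_fun (congrArg ModuleCat.Hom.hom (hσ.left i hi p)) x
  have hright : ∀ j, σ.symm j = none →
      ∀ p x, intervalMap k (C j) p (translate ε (translate ε p)) x = 0 := fun j hj p x =>
    LinearMap.congr_fun (congrArg ModuleCat.Hom.hom (hσ.right j hj p)) x
  have hsymm : ∀ j i, σ.symm j = some i → σ i = some j := fun j i h => (PEquiv.eq_some_iff σ).1 h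
  let F := fun p => matchMap σ p (fun i j => φ i j p)
  let G := fun p => matchMap σ.symm p (fun j i => ψ i j p)
  refine interleaved_iff.2
    ⟨fun p => (eN (translate ε p)).symm.toLinearMap ∘ₗ F p ∘ₗ (eM p).toLinearMap,
      fun p => (eM (translate ε p)).symm.toLinearMap ∘ₗ G p ∘ₗ (eN p).toLinearMap,
      fun p q h x => ?_, fun p q h x => ?_, fun p x => ?_, fun p x => ?_⟩
  · refine (LinearEquiv.symm_apply_eq _).2 ?_
    rw [heN]
    simp only [LinearMap.comp_apply, LinearEquiv.coe_coe, LinearEquiv.apply_symm_apply, heM p q h]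
    exact matchMap_sumMap φ (fun i j hij => (hφψ i j hij).1) h (eM p x)
  · refine (LinearEquiv.symm_apply_eq _).2 ?_
    rw [heM]
    simp only [LinearMap.comp_apply, LinearEquiv.coe_coe, LinearEquiv.apply_symm_apply, heN p q h]
    exact matchMap_sumMap (fun j i => ψ i j)
      (fun j i hij => (hφψ i j (hsymm j i hij)).2.1) h (eN p x)
  · refine (LinearEquiv.symm_apply_eq _).2 ?_
    rw [heM]
    simp only [LinearMap.comp_apply, LinearEquiv.coe_coe, LinearEquiv.apply_symm_apply]
    exact matchMap_matchMap φ (fun j i => ψ i j) (fun i j hij => (hφψ i j hij).2.2.1) hleft p (eM p x)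
  · refine (LinearEquiv.symm_apply_eq _).2 ?_
    rw [heN]
    simp only [LinearMap.comp_apply, LinearEquiv.coe_coe, LinearEquiv.apply_symm_apply]
    exact matchMap_matchMap (σ := σ.symm) (fun j i => ψ i j) φ
      (fun j i hij => (hφψ i j (hsymm j i hij)).2.2.2) hright p (eN p x)

lemma Matched.interleaved {M N : PersistenceModule.{u, v} k (Rn n)} (h : Matched ε M N) :
    Interleaved ε M N := by
  obtain ⟨⟨ι, B, hB⟩, ⟨κ, C, hC⟩, h⟩ := h
  obtain ⟨σ, hσ⟩ := h ι κ B C hB hC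
  exact hσ.interleaved hB hC

lemma interleavingDist_le_bottleneckDist (M N : PersistenceModule.{u, v} k (Rn n)) :
    interleavingDist M N ≤ bottleneckDist M N :=
  le_iInf₂ fun ε h => iInf₂_le ε h.interleaved

end Matching

/-! ### Matchings in infinite bipartite graphs -/

/-- The points reached from a point of `A` outside the range of `g` by following `f` and `g`
alternately. -/
inductive AlternatingChain {ι κ : Type*} {A : Set ι} {B : Set κ} (f : A → κ) (g : B → ι) : ι → Prop
  | base (i : ι) (hA : i ∈ A) (h : ∀ j, g j ≠ i) : AlternatingChain f g i
  | step (i : A) (hi : AlternatingChain f g i) (j : B) (hj : f i = j) (hA : g j ∈ A) :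
      AlternatingChain f g (g j)

lemma exists_option_of_rel {α β : Type*} (r : α → β → Prop)
    (hr : ∀ a b b', r a b → r a b' → b = b') :
    ∃ f : α → Option β, ∀ a b, f a = some b ↔ r a b := by
  classical
  refine ⟨fun a => if h : ∃ b, r a b then some h.choose else none, fun a b => ?_⟩
  by_cases h : ∃ b, r a b
  · simp only [h, dif_pos, Option.some.injEq]
    exact ⟨fun e => e ▸ h.choose_spec, fun hb => hr _ _ _ h.choose_spec hb⟩
  · simp only [h, dif_neg, not_false_eq_true]
    exact ⟨fun e => by simp at e, fun hb => absurd ⟨b, hb⟩ h⟩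

/-- A relation that is functional in both directions is a partial equivalence. -/
lemma exists_pequiv_of_rel {ι κ : Type*} (m : ι → κ → Prop)
    (h₁ : ∀ i j j', m i j → m i j' → j = j') (h₂ : ∀ i i' j, m i j → m i' j → i = i') :
    ∃ σ : ι ≃. κ, ∀ i j, σ i = some j ↔ m i j := by
  obtain ⟨f, hf⟩ := exists_option_of_rel m h₁
  obtain ⟨g, hg⟩ := exists_option_of_rel (fun j i => m i j) (fun j i i' => h₂ i i' j)
  exact ⟨⟨f, g, fun i j => by rw [hf, hg]⟩, hf⟩

/-- Two partial injections in opposite directions combine to a partial bijection defined wherever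
one of them is. -/
lemma exists_pequiv_of_injective {ι κ : Type*} {R : ι → κ → Prop} {A : Set ι} {B : Set κ}
    {f : A → κ} {g : B → ι} (hf : Function.Injective f) (hg : Function.Injective g)
    (hfR : ∀ i : A, R i (f i)) (hgR : ∀ j : B, R (g j) j) :
    ∃ σ : ι ≃. κ, (∀ i ∈ A, σ i ≠ none) ∧ (∀ j ∈ B, σ.symm j ≠ none) ∧
      ∀ i j, σ i = some j → R i j := by
  -- As in Cantor–Bernstein: on `S` the matching follows `f`, and elsewhere it follows `g`
  -- backwards.
  set S := AlternatingChain f g with hS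
  -- A chain arriving at `g j` cannot begin there, so its last step passed through `j` as an
  -- `f`-image; this excludes conflicts between the two rules.
  have hSg : ∀ j : B, S (g j) → ∃ i : A, S i ∧ f i = j := by
    intro j hj
    generalize hi : g j = i at hj
    cases hj with
    | base i hA h => exact absurd hi (h j)
    | step i hi' j' hj' hA =>
      obtain rfl := hg hi
      exact ⟨i, hi', hj'⟩
  let m : ι → κ → Prop := fun i j => (∃ h : i ∈ A, S i ∧ f ⟨i, h⟩ = j) ∨
    ∃ h : j ∈ B, (¬ ∃ i : A, S i ∧ f i = j) ∧ g ⟨j, h⟩ = i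
  have hm₁ : ∀ i j j', m i j → m i j' → j = j' := by
    rintro i j j' (⟨hi, hSi, rfl⟩ | ⟨hj, hn, rfl⟩) (⟨hi', hSi', rfl⟩ | ⟨hj', hn', h⟩)
    · rfl
    · subst h
      exact absurd (hSg _ hSi) hn'
    · exact absurd (hSg _ hSi') hn
    · exact congrArg Subtype.val (hg h.symm)
  have hm₂ : ∀ i i' j, m i j → m i' j → i = i' := by
    rintro i i' j (⟨hi, hSi, rfl⟩ | ⟨hj, hn, rfl⟩) (⟨hi', hSi', h⟩ | ⟨hj', hn', rfl⟩)
    · exact congrArg Subtype.val (hf h.symm)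
    · exact absurd ⟨_, hSi, rfl⟩ hn'
    · exact absurd ⟨_, hSi', h⟩ hn
    · rfl
  obtain ⟨σ, hσ⟩ := exists_pequiv_of_rel m hm₁ hm₂
  have hsymm : ∀ {i j}, σ i = some j → σ.symm j = some i := fun h => (PEquiv.eq_some_iff σ).2 h
  refine ⟨σ, fun i hi hn => ?_, fun j hj hn => ?_, fun i j hij => ?_⟩
  · by_cases hSi : S i
    · have := (hσ i (f ⟨i, hi⟩)).2 (Or.inl ⟨hi, hSi, rfl⟩)
      simp [hn] at this
    · have hex : ∃ j, g j = i := by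
        by_contra hne
        exact hSi (.base i hi fun j hj => hne ⟨j, hj⟩)
      obtain ⟨j, rfl⟩ := hex
      have := (hσ (g j) j).2 (Or.inr ⟨j.2, fun ⟨i, hi', hij⟩ => hSi (.step i hi' j hij hi), rfl⟩)
      simp [hn] at this
  · by_cases h : ∃ i : A, S i ∧ f i = j
    · obtain ⟨i, hi, rfl⟩ := h
      have := hsymm ((hσ i (f i)).2 (Or.inl ⟨i.2, hi, rfl⟩))
      simp [hn] at this
    · have := hsymm ((hσ (g ⟨j, hj⟩) j).2 (Or.inr ⟨hj, h, rfl⟩))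
      simp [hn] at this
  · obtain ⟨hi, -, rfl⟩ | ⟨hj, -, rfl⟩ := (hσ i j).1 hij
    · exact hfR ⟨i, hi⟩
    · exact hgR ⟨j, hj⟩

/-- For infinite `D`, the product of ℕ with `D` has the cardinality of `D`. The map is total and the
condition sits inside the statement, so that maps can be chosen for all classes at once. -/
lemma exists_absorb_nat {κ : Type*} (D : Set κ) :
    ∃ θ : ℕ → κ → κ, D.Infinite → (∀ m, ∀ j ∈ D, θ m j ∈ D) ∧
      ∀ m m', ∀ j ∈ D, ∀ j' ∈ D, θ m j = θ m' j' → m = m' ∧ j = j' := by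
  classical
  by_cases hD : D.Infinite
  · have := hD.to_subtype
    have hle : Cardinal.mk (ULift.{_, 0} ℕ × D) ≤ Cardinal.mk D := by
      simp
    obtain ⟨θ⟩ := hle
    refine ⟨fun m j => if h : j ∈ D then θ (⟨m⟩, ⟨j, h⟩) else j, fun _ => ⟨fun m j hj => ?_, ?_⟩⟩
    · simp [hj]
    · intro m m' j hj j' hj' h
      simp only [hj, hj', dif_pos] at h
      have := θ.injective (Subtype.ext h)
      simpa using this
  · exact ⟨fun _ => id, fun h => absurd h hD⟩

lemma exists_mapsTo_injOn {κ : Type v} (D D' : Set κ) :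
    ∃ θ : κ → κ, Cardinal.mk D ≤ Cardinal.mk D' → Set.MapsTo θ D D' ∧ Set.InjOn θ D := by
  classical
  by_cases h : Cardinal.mk D ≤ Cardinal.mk D'
  · obtain ⟨θ⟩ := id h
    refine ⟨fun j => if h : j ∈ D then θ ⟨j, h⟩ else j, fun _ => ⟨fun j hj => ?_, ?_⟩⟩
    · simp [hj]
    · intro j hj j' hj' h
      simp only [hj, hj', dif_pos] at h
      exact congrArg Subtype.val (θ.injective (Subtype.ext h))
  · exact ⟨id, fun hle => absurd hle h⟩

/-- A form of Hall's theorem without finiteness of the degrees: the vertices are grouped into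
countably many classes, adjacency depends on the classes only, and a class is adjacent to finitely
many classes. Besides Hall's condition, it requires a countable-to-one choice of neighbours. -/
theorem exists_injective_of_locallyFinite {ι κ : Type v} {X Y : Type*} [Countable Y]
    (c : ι → X) (d : κ → Y) (E : X → Y → Prop) (hE : ∀ x, {y | E x y}.Finite)
    (hall : ∀ (A : Finset ι) (T : Finset κ), (∀ i ∈ A, ∀ j, E (c i) (d j) → j ∈ T) →
      A.card ≤ T.card)
    (h : ι → κ) (hh : ∀ i, E (c i) (d (h i))) (hc : ∀ j, {i | h i = j}.Countable) :
    ∃ f : ι → κ, Function.Injective f ∧ ∀ i, E (c i) (d (f i)) := by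
  classical
  -- Points of `S` have finitely many neighbours, so the ordinary Hall theorem applies to them.
  let S : Set ι := {i | ∀ y, E (c i) y → (d ⁻¹' {y}).Finite}
  have hfin : ∀ i ∈ S, {j | E (c i) (d j)}.Finite := by
    intro i hi
    refine ((hE (c i)).biUnion hi).subset fun j hj => ?_
    exact Set.mem_biUnion (x := d j) hj rfl
  obtain ⟨f₁, hf₁, hf₁E⟩ : ∃ f : S → κ, Function.Injective f ∧ ∀ i : S, E (c i) (d (f i)) := by
    let t : S → Finset κ := fun i => (hfin i i.2).toFinset
    obtain ⟨f, hf, hft⟩ := (Finset.all_card_le_biUnion_card_iff_exists_injective t).1 fun A => by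
      have := hall (A.map (Function.Embedding.subtype _)) (A.biUnion t) (by
        intro i hi j hj
        obtain ⟨i', hi', rfl⟩ := Finset.mem_map.1 hi
        exact Finset.mem_biUnion.2 ⟨i', hi', (hfin i' i'.2).mem_toFinset.2 hj⟩)
      simpa using this
    exact ⟨f, hf, fun i => (hfin i i.2).mem_toFinset.1 (hft i)⟩
  -- Numbering each countable fibre of `h` makes the pair (`h i`, `e i`) determine `i`.
  obtain ⟨e, he⟩ : ∃ e : ι → ℕ, ∀ i i', h i = h i' → e i = e i' → i = i' := by
    have := fun j => Set.countable_iff_exists_injOn.1 (hc j)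
    choose e he using this
    refine ⟨fun i => e (h i) i, fun i i' hi hei => ?_⟩
    simp only [← hi] at hei
    exact he (h i) rfl hi.symm hei
  obtain ⟨code, hcode⟩ := exists_injective_nat (Y × ℕ)
  choose θ hθ using fun y => exists_absorb_nat (d ⁻¹' {y})
  choose emb hemb using fun y y' => exists_mapsTo_injOn (d ⁻¹' {y}) (d ⁻¹' {y'})
  -- Outside `S`, pick an adjacent class of largest cardinality. It exists as only finitely many
  -- classes are adjacent; it is infinite and receives an injection from the class of `h i`.
  have hmax : ∀ i, ∃ y, i ∉ S → E (c i) y ∧ (d ⁻¹' {y}).Infinite ∧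
      ∀ y', E (c i) y' → Cardinal.mk (d ⁻¹' {y'}) ≤ Cardinal.mk (d ⁻¹' {y}) := by
    intro i
    by_cases hi : i ∈ S
    · exact ⟨d (h i), fun h => absurd hi h⟩
    · simp only [S, Set.mem_ofPred_eq, not_forall] at hi
      obtain ⟨y', hy', hinf⟩ := hi
      obtain ⟨y, hy, hym⟩ := Set.exists_max_image {y | E (c i) y}
        (fun y => Cardinal.mk (d ⁻¹' {y})) (hE (c i)) ⟨y', hy'⟩
      refine ⟨y, fun _ => ⟨hy, ?_, hym⟩⟩
      have := (Cardinal.infinite_iff.1 (Set.Infinite.to_subtype hinf)).trans (hym y' hy')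
      exact Set.infinite_coe_iff.1 (Cardinal.infinite_iff.2 this)
  choose top htop using hmax
  -- Move `h i` into the chosen class and absorb the countable data (original class, fibre number)
  -- there; from the result `h i` and `e i`, hence `i`, can be recovered.
  let f₂ : ι → κ := fun i =>
    θ (top i) (code (d (h i), e i)) (emb (d (h i)) (top i) (h i))
  have hembmem : ∀ i ∉ S, emb (d (h i)) (top i) (h i) ∈ d ⁻¹' {top i} := fun i hi =>
    (hemb _ _ ((htop i hi).2.2 _ (hh i))).1 rfl
  have hf₂d : ∀ i ∉ S, d (f₂ i) = top i := fun i hi =>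
    (hθ _ (htop i hi).2.1).1 _ _ (hembmem i hi)
  have hf₂ : ∀ i ∉ S, ∀ i' ∉ S, f₂ i = f₂ i' → i = i' := by
    intro i hi i' hi' heq
    have htt : top i = top i' := by rw [← hf₂d i hi, ← hf₂d i' hi', heq]
    have hm' := hembmem i' hi'
    simp only [f₂] at heq
    rw [← htt] at heq hm'
    obtain ⟨h1, h2⟩ := (hθ _ (htop i hi).2.1).2 _ _ _ (hembmem i hi) _ hm' heq
    have h3 := hcode h1
    simp only [Prod.mk.injEq] at h3
    obtain ⟨h4, h5⟩ := h3
    rw [← h4] at h2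
    exact he i i' ((hemb _ _ ((htop i hi).2.2 _ (hh i))).2 rfl h4.symm h2) h5
  -- Values of `f₁` lie in finite classes, those of `f₂` outside `S` in infinite ones.
  have hcross : ∀ (i : S), ∀ i' ∉ S, f₁ i ≠ f₂ i' := by
    intro i i' hi' heq
    have h1 := i.2 _ (hf₁E i)
    rw [heq, hf₂d i' hi'] at h1
    exact (htop i' hi').2.1 h1
  refine ⟨fun i => if hi : i ∈ S then f₁ ⟨i, hi⟩ else f₂ i, fun i i' heq => ?_, fun i => ?_⟩
  · by_cases hi : i ∈ S <;> by_cases hi' : i' ∈ S <;> simp only [hi, hi', dif_pos, dif_neg,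
      not_false_eq_true] at heq
    · exact congrArg Subtype.val (hf₁ heq)
    · exact absurd heq (hcross _ _ hi')
    · exact absurd heq.symm (hcross _ _ hi)
    · exact hf₂ i hi i' hi' heq
  · by_cases hi : i ∈ S
    · simpa only [hi, dif_pos] using hf₁E ⟨i, hi⟩
    · simp only [hi, dif_neg, not_false_eq_true, hf₂d i hi]
      exact (htop i hi).1

/-! ### Families of extended real endpoints -/

section Endpoints

variable {E : Type}

open Classical in
/-- The number of entries `⊤` minus the number of entries `⊥`, followed by the sum of the real
entries, in lexicographic order. -/
def alpha [Fintype E] (X : E → EReal) : ℤ ×ₗ ℝ :=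
  toLex (((Finset.univ.filter fun e => X e = ⊤).card : ℤ) -
    (Finset.univ.filter fun e => X e = ⊥).card, ∑ e, (X e).toReal)

/-- The entries of `X` and `Y` have the same infinite values and real values at distance at most
`δ`. -/
def EndpointsClose (δ : ℝ) (X Y : E → EReal) : Prop :=
  ∀ e, (X e = ⊤ ↔ Y e = ⊤) ∧ (X e = ⊥ ↔ Y e = ⊥) ∧ |(X e).toReal - (Y e).toReal| ≤ δ

lemma EndpointsClose.symm {δ : ℝ} {X Y : E → EReal} (h : EndpointsClose δ X Y) :
    EndpointsClose δ Y X := fun e =>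
  ⟨(h e).1.symm, (h e).2.1.symm, abs_sub_comm (X e).toReal _ ▸ (h e).2.2⟩

/-- The bound on `Y` can only remove entries ⊤ and add entries ⊥, so the integer part of `alpha`
cannot grow; the assumed inequality forces the infinite entries to agree, and then compares the sums
of the real parts. Infinite entries have real part 0 and contribute slack δ each. -/
lemma endpoints_of_alpha_le [Fintype E] {X Y : E → EReal} {δ : ℝ} (hδ : 0 ≤ δ)
    (hle : ∀ e, Y e ≤ X e + (δ : EReal)) (hα : alpha X ≤ alpha Y) :
    (∀ e, X e = ⊤ ↔ Y e = ⊤) ∧ (∀ e, X e = ⊥ ↔ Y e = ⊥) ∧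
      (∀ e, 0 ≤ (X e).toReal + δ - (Y e).toReal) ∧
      ∑ e, ((X e).toReal + δ - (Y e).toReal) ≤ Fintype.card E * δ := by
  classical
  have htop : (Finset.univ.filter fun e => Y e = ⊤) ⊆ Finset.univ.filter fun e => X e = ⊤ := by
    intro e he
    simp only [Finset.mem_filter, Finset.mem_univ, true_and] at he ⊢
    have := hle e
    rw [he, top_le_iff] at this
    by_contra h
    exact EReal.add_ne_top h (EReal.coe_ne_top δ) this
  have hbot : (Finset.univ.filter fun e => X e = ⊥) ⊆ Finset.univ.filter fun e => Y e = ⊥ := by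
    intro e he
    simp only [Finset.mem_filter, Finset.mem_univ, true_and] at he ⊢
    have := hle e
    rwa [he, EReal.bot_add, le_bot_iff] at this
  have h1 := Finset.card_le_card htop
  have h2 := Finset.card_le_card hbot
  have hlex := Prod.Lex.le_iff.1 hα
  simp only [alpha, ofLex_toLex] at hlex
  have heq : (Finset.univ.filter fun e => X e = ⊤).card = (Finset.univ.filter fun e => Y e = ⊤).card ∧
      (Finset.univ.filter fun e => X e = ⊥).card = (Finset.univ.filter fun e => Y e = ⊥).card := by
    rcases hlex with h | ⟨h, -⟩ <;> omega
  have hsum : ∑ e, (X e).toReal ≤ ∑ e, (Y e).toReal := by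
    rcases hlex with h | ⟨-, h⟩
    · omega
    · exact h
  have htop' := Finset.eq_of_subset_of_card_le htop heq.1.le
  have hbot' := Finset.eq_of_subset_of_card_le hbot heq.2.ge
  have t : ∀ e, X e = ⊤ ↔ Y e = ⊤ := fun e => by
    have := Finset.ext_iff.1 htop' e
    simpa using this.symm
  have b : ∀ e, X e = ⊥ ↔ Y e = ⊥ := fun e => by
    have := Finset.ext_iff.1 hbot' e
    simpa using this
  refine ⟨t, b, fun e => ?_, ?_⟩
  · by_cases ht : X e = ⊤
    · rw [(t e).1 ht, ht]
      simpa using hδ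
    by_cases hb : X e = ⊥
    · rw [(b e).1 hb, hb]
      simpa using hδ
    have := hle e
    rw [← EReal.coe_toReal ht hb, ← EReal.coe_toReal (fun h => ht ((t e).2 h))
      (fun h => hb ((b e).2 h)), ← EReal.coe_add, EReal.coe_le_coe_iff] at this
    linarith
  · rw [Finset.sum_sub_distrib, Finset.sum_add_distrib]
    simp only [Finset.sum_const, Finset.card_univ, nsmul_eq_mul]
    linarith

/-- Each slack lies between 0 and the total, at most card · δ. Removing the built-in δ leaves card -
1 in one direction; the other bound is δ, absorbed because card ≥ 2. -/
lemma endpointsClose_of_alpha_le [Fintype E] {X Y : E → EReal} {δ : ℝ} (hδ : 0 ≤ δ)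
    (hE : 2 ≤ Fintype.card E) (hle : ∀ e, Y e ≤ X e + (δ : EReal)) (hα : alpha X ≤ alpha Y) :
    EndpointsClose ((Fintype.card E - 1) * δ) X Y := by
  obtain ⟨t, b, h0, hsum⟩ := endpoints_of_alpha_le hδ hle hα
  refine fun e => ⟨t e, b e, abs_le.2 ⟨?_, ?_⟩⟩
  · have := h0 e
    have h2 : (2 : ℝ) ≤ Fintype.card E := by exact_mod_cast hE
    nlinarith
  · have := (Finset.single_le_sum (fun e _ => h0 e) (Finset.mem_univ e)).trans hsum
    linarith

/-- The entries rounded down to multiples of `η`. -/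
def roundedKey (η : ℝ) (X : E → EReal) : E → Prop × Prop × ℤ :=
  fun e => (X e = ⊤, X e = ⊥, ⌊(X e).toReal / η⌋)

/-- Two keys agree up to `K` grid steps. -/
def KeysClose (K : ℕ) (x y : E → Prop × Prop × ℤ) : Prop :=
  ∀ e, (x e).1 = (y e).1 ∧ (x e).2.1 = (y e).2.1 ∧ |(x e).2.2 - (y e).2.2| ≤ K

lemma finite_keysClose [Finite E] (K : ℕ) (x : E → Prop × Prop × ℤ) :
    {y | KeysClose K x y}.Finite := by
  refine (Set.Finite.pi' (t := fun e => Set.univ ×ˢ Set.univ ×ˢ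
    Set.Icc ((x e).2.2 - K) ((x e).2.2 + K)) fun e => ?_).subset fun y hy e => ?_
  · exact Set.finite_univ.prod (Set.finite_univ.prod (Set.finite_Icc _ _))
  · have := abs_le.1 (hy e).2.2
    exact ⟨trivial, trivial, by constructor <;> linarith⟩

lemma EndpointsClose.keysClose {δ η : ℝ} (hη : 0 < η) {X Y : E → EReal}
    (h : EndpointsClose δ X Y) :
    KeysClose (⌈δ / η⌉₊ + 1) (roundedKey η X) (roundedKey η Y) := by
  intro e
  obtain ⟨h1, h2, h3⟩ := h e
  refine ⟨propext h1, propext h2, ?_⟩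
  simp only [roundedKey]
  have hdiv : |(X e).toReal / η - (Y e).toReal / η| ≤ ⌈δ / η⌉₊ := by
    rw [← sub_div, abs_div, abs_of_pos hη]
    exact (div_le_div_of_nonneg_right h3 hη.le).trans (Nat.le_ceil _)
  have hx := Int.floor_le ((X e).toReal / η)
  have hx' := Int.lt_floor_add_one ((X e).toReal / η)
  have hy := Int.floor_le ((Y e).toReal / η)
  have hy' := Int.lt_floor_add_one ((Y e).toReal / η)
  have := abs_le.1 hdiv
  have key : (|⌊(X e).toReal / η⌋ - ⌊(Y e).toReal / η⌋| : ℝ) ≤ ⌈δ / η⌉₊ + 1 :=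
    abs_le.2 ⟨by linarith, by linarith⟩
  exact_mod_cast key

/-- Of the 3η lost, one comes from the ceiling, one from the extra grid step and one from the
floors. -/
lemma KeysClose.endpointsClose {δ η : ℝ} (hδ : 0 ≤ δ) (hη : 0 < η) {X Y : E → EReal}
    (h : KeysClose (⌈δ / η⌉₊ + 1) (roundedKey η X) (roundedKey η Y)) :
    EndpointsClose (δ + 3 * η) X Y := by
  intro e
  obtain ⟨h1, h2, h3⟩ := h e
  refine ⟨h1.to_iff, h2.to_iff, ?_⟩
  simp only [roundedKey] at h3
  have h3' : (|⌊(X e).toReal / η⌋ - ⌊(Y e).toReal / η⌋| : ℝ) ≤ ⌈δ / η⌉₊ + 1 := by exact_mod_cast h3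
  have hc : (⌈δ / η⌉₊ : ℝ) < δ / η + 1 := Nat.ceil_lt_add_one (by positivity)
  have hx := Int.floor_le ((X e).toReal / η)
  have hx' := Int.lt_floor_add_one ((X e).toReal / η)
  have hy := Int.floor_le ((Y e).toReal / η)
  have hy' := Int.lt_floor_add_one ((Y e).toReal / η)
  have := abs_le.1 h3'
  have hdiv : |(X e).toReal / η - (Y e).toReal / η| ≤ δ / η + 3 :=
    abs_le.2 ⟨by linarith, by linarith⟩
  rw [← sub_div, abs_div, abs_of_pos hη, div_le_iff₀ hη] at hdiv
  have : (δ / η + 3) * η = δ + 3 * η := by field_simp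
  linarith

end Endpoints

/-! ### Rectangles -/

section Rectangles

variable {n : ℕ}

lemma translate_apply (ε : ℝ≥0) (p : Rn n) (l : Fin n) : translate ε p l = p l + ε := rfl

/-- The infimum of the `l`-th coordinate on `I`. -/
def lower (I : PInterval (Rn n)) (l : Fin n) : EReal := ⨅ p ∈ I.carrier, ((p l : ℝ) : EReal)

/-- The supremum of the `l`-th coordinate on `I`. -/
def upper (I : PInterval (Rn n)) (l : Fin n) : EReal := ⨆ p ∈ I.carrier, ((p l : ℝ) : EReal)

/-- All lower and upper endpoints of `I`. -/
def endpoints (I : PInterval (Rn n)) : Fin n ⊕ Fin n → EReal := Sum.elim (lower I) (upper I)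

/-- `I` contains a point together with its translate by `2 * c`. -/
def Significant (c : ℝ≥0) (I : PInterval (Rn n)) : Prop :=
  ∃ p ∈ I.carrier, translate c (translate c p) ∈ I.carrier

lemma lower_le {I : PInterval (Rn n)} {p : Rn n} (hp : p ∈ I.carrier) (l : Fin n) :
    lower I l ≤ ((p l : ℝ) : EReal) := iInf₂_le p hp

lemma le_upper {I : PInterval (Rn n)} {p : Rn n} (hp : p ∈ I.carrier) (l : Fin n) :
    ((p l : ℝ) : EReal) ≤ upper I l :=
  le_iSup₂ (f := fun p (_ : p ∈ I.carrier) => ((p l : ℝ) : EReal)) p hp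

lemma lower_ne_top (I : PInterval (Rn n)) (l : Fin n) : lower I l ≠ ⊤ := by
  obtain ⟨p, hp⟩ := I.nonempty
  exact ne_top_of_le_ne_top (EReal.coe_ne_top _) (lower_le hp l)

lemma upper_ne_bot (I : PInterval (Rn n)) (l : Fin n) : upper I l ≠ ⊥ := by
  obtain ⟨p, hp⟩ := I.nonempty
  exact ne_bot_of_le_ne_bot (EReal.coe_ne_bot _) (le_upper hp l)

lemma IsRectangle.mem {I : PInterval (Rn n)} (hI : IsRectangle I) {p : Rn n}
    (h : ∀ l, ∃ q ∈ I.carrier, q l = p l) : p ∈ I.carrier := by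
  obtain ⟨R, hR⟩ := hI
  rw [hR]
  intro l
  obtain ⟨q, hq, hl⟩ := h l
  rw [hR] at hq
  exact hl ▸ hq l

/-- Witnesses of the strict bounds in the separate coordinates assemble into one point of `I`,
thanks to the product form; order-convexity does the rest. -/
lemma IsRectangle.mem_of_lower_lt {I : PInterval (Rn n)} (hI : IsRectangle I) {p q : Rn n}
    (h : ∀ l, lower I l < ((p l : ℝ) : EReal)) (hpq : p ≤ q) (hq : q ∈ I.carrier) :
    p ∈ I.carrier := by
  have h1 : ∀ l, ∃ q ∈ I.carrier, q l < p l := fun l => by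
    obtain ⟨q, hq, hlt⟩ := by simpa only [lower, iInf_lt_iff] using h l
    exact ⟨q, hq, EReal.coe_lt_coe_iff.1 hlt⟩
  choose r hr hrp using h1
  have hr' : (fun l => r l l : Rn n) ∈ I.carrier := hI.mem fun l => ⟨r l, hr l, rfl⟩
  exact I.ordConnected.out hr' hq ⟨fun l => (hrp l).le, hpq⟩

lemma IsRectangle.mem_of_lt_upper {I : PInterval (Rn n)} (hI : IsRectangle I) {p q : Rn n}
    (h : ∀ l, ((p l : ℝ) : EReal) < upper I l) (hqp : q ≤ p) (hq : q ∈ I.carrier) :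
    p ∈ I.carrier := by
  have h1 : ∀ l, ∃ q ∈ I.carrier, p l < q l := fun l => by
    obtain ⟨q, hq, hlt⟩ := by simpa only [upper, lt_iSup_iff] using h l
    exact ⟨q, hq, EReal.coe_lt_coe_iff.1 hlt⟩
  choose r hr hpr using h1
  have hr' : (fun l => r l l : Rn n) ∈ I.carrier := hI.mem fun l => ⟨r l, hr l, rfl⟩
  exact I.ordConnected.out hq hr' ⟨hqp, fun l => (hpr l).le⟩

lemma IsRectangle.mem_of_lt {I : PInterval (Rn n)} (hI : IsRectangle I) {p : Rn n}
    (h : ∀ l, lower I l < ((p l : ℝ) : EReal) ∧ ((p l : ℝ) : EReal) < upper I l) :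
    p ∈ I.carrier := by
  have h2 : ∀ l, ∃ q ∈ I.carrier, p l < q l := fun l => by
    obtain ⟨q, hq, hlt⟩ := by simpa only [upper, lt_iSup_iff] using (h l).2
    exact ⟨q, hq, EReal.coe_lt_coe_iff.1 hlt⟩
  choose r hr hpr using h2
  have hr' : (fun l => r l l : Rn n) ∈ I.carrier := hI.mem fun l => ⟨r l, hr l, rfl⟩
  exact hI.mem_of_lower_lt (fun l => (h l).1) (fun l => (hpr l).le) hr'

lemma IsRectangle.min_mem {I : PInterval (Rn n)} (hI : IsRectangle I) {p q : Rn n}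
    (hp : p ∈ I.carrier) (hq : q ∈ I.carrier) : (fun l => min (p l) (q l) : Rn n) ∈ I.carrier := by
  refine hI.mem fun l => ?_
  rcases min_choice (p l) (q l) with h | h
  · exact ⟨p, hp, h.symm⟩
  · exact ⟨q, hq, h.symm⟩

lemma IsRectangle.max_mem {I : PInterval (Rn n)} (hI : IsRectangle I) {p q : Rn n}
    (hp : p ∈ I.carrier) (hq : q ∈ I.carrier) : (fun l => max (p l) (q l) : Rn n) ∈ I.carrier := by
  refine hI.mem fun l => ?_
  rcases max_choice (p l) (q l) with h | h
  · exact ⟨p, hp, h.symm⟩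
  · exact ⟨q, hq, h.symm⟩

/-! ### Morphisms between rectangle modules -/

section HomScalars

variable {k : Type u} [Field k] {ε : ℝ≥0} {I J : PInterval (Rn n)} {c : Rn n → k}

/-- The common value of the nonzero scalars of a morphism between rectangle modules. -/
def homWeight (c : Rn n → k) : k :=
  open Classical in if h : ∃ p, c p ≠ 0 then c h.choose else 0

lemma exists_of_homWeight_ne_zero (h : homWeight c ≠ 0) : ∃ p, c p ≠ 0 := by
  by_contra hn
  exact h (dif_neg hn)

lemma IsHomScalar.mem_target_of_le (hc : IsHomScalar (translate ε) I.carrier J.carrier c)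
    {p q : Rn n} (hp : c p ≠ 0) (hq : q ∈ I.carrier) (hqp : q ≤ p) : translate ε q ∈ J.carrier :=
  hc.mem_target (hc.eq_of_le hqp hq (hc.mem_target hp) ▸ hp)

lemma IsHomScalar.mem_source_of_le (hc : IsHomScalar (translate ε) I.carrier J.carrier c)
    {p q : Rn n} (hp : c p ≠ 0) (hq : translate ε q ∈ J.carrier) (hpq : p ≤ q) : q ∈ I.carrier :=
  hc.mem_source (hc.eq_of_le hpq (hc.mem_source hp) hq ▸ hp)

/-- Two points of a rectangle are compared through their coordinatewise minimum, which again lies in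
the rectangle. -/
lemma IsHomScalar.eq_homWeight (hI : IsRectangle I)
    (hc : IsHomScalar (translate ε) I.carrier J.carrier c)
    {p : Rn n} (hp : p ∈ I.carrier) (hp' : translate ε p ∈ J.carrier) : c p = homWeight c := by
  by_cases h : ∃ p, c p ≠ 0
  · rw [homWeight, dif_pos h]
    have h0 := h.choose_spec
    have hm := hI.min_mem hp (hc.mem_source h0)
    rw [← hc.eq_of_le (fun l => min_le_left _ _) hm hp',
      hc.eq_of_le (fun l => min_le_right _ _) hm (hc.mem_target h0)]
  · rw [homWeight, dif_neg h]
    by_contra hne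
    exact h ⟨p, hne⟩

lemma IsHomScalar.eq_zero_of_homWeight (hI : IsRectangle I)
    (hc : IsHomScalar (translate ε) I.carrier J.carrier c) (h : homWeight c = 0) (p : Rn n) :
    c p = 0 := by
  by_contra hne
  exact hne ((hc.eq_homWeight hI (hc.mem_source hne) (hc.mem_target hne)).trans h)

lemma IsHomScalar.endpoints_le (hI : IsRectangle I) (hJ : IsRectangle J)
    (hc : IsHomScalar (translate ε) I.carrier J.carrier c) (h : homWeight c ≠ 0)
    (e : Fin n ⊕ Fin n) : endpoints J e ≤ endpoints I e + ((ε : ℝ) : EReal) := by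
  obtain ⟨p, hp⟩ := exists_of_homWeight_ne_zero h
  rcases e with l | l
  · refine (EReal.sub_le_iff_le_add (Or.inl (EReal.coe_ne_bot _)) (Or.inl (EReal.coe_ne_top _))).1
      (le_iInf₂ fun q hq => ?_)
    refine (EReal.sub_le_iff_le_add (Or.inl (EReal.coe_ne_bot _)) (Or.inl (EReal.coe_ne_top _))).2 ?_
    have hm := hc.mem_target_of_le hp (hI.min_mem hq (hc.mem_source hp)) fun l => min_le_right _ _
    refine (lower_le hm l).trans ?_
    rw [← EReal.coe_add, EReal.coe_le_coe_iff]
    exact add_le_add_left (min_le_left _ _) _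
  · refine iSup₂_le fun q hq => ?_
    refine (EReal.sub_le_iff_le_add (Or.inl (EReal.coe_ne_bot _)) (Or.inl (EReal.coe_ne_top _))).1 ?_
    have hm := hJ.max_mem hq (hc.mem_target hp)
    -- The point of `J` is first raised above `translate ε p`; shifting back by ε then lands in the
    -- source.
    set r : Rn n := fun l => max (q l) (translate ε p l) - ε with hr
    have hr' : translate ε r = fun l => max (q l) (translate ε p l) :=
      funext fun l => by simp [translate, hr]
    have hrI : r ∈ I.carrier := by
      refine hc.mem_source_of_le hp (hr' ▸ hm) fun l => ?_
      have := le_max_right (q l) (translate ε p l)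
      rw [translate_apply] at this
      simp only [hr, translate_apply]
      linarith
    refine le_trans ?_ (le_upper hrI l)
    rw [← EReal.coe_sub, EReal.coe_le_coe_iff]
    exact sub_le_sub_right (le_max_left _ _) _

/-- The middle point is squeezed between two points of `J`: a lower one pushed forward from `I` and
an upper one pulled back from `K`. -/
lemma translate_mem_of_homWeight_ne_zero {K : PInterval (Rn n)} {d : Rn n → k}
    (hI : IsRectangle I) (hK : IsRectangle K)
    (hc : IsHomScalar (translate ε) I.carrier J.carrier c)
    (hd : IsHomScalar (translate ε) J.carrier K.carrier d)
    (h : homWeight c ≠ 0) (h' : homWeight d ≠ 0) {p : Rn n} (hp : p ∈ I.carrier)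
    (hp' : translate ε (translate ε p) ∈ K.carrier) : translate ε p ∈ J.carrier := by
  obtain ⟨q, hq⟩ := exists_of_homWeight_ne_zero h
  obtain ⟨r, hr⟩ := exists_of_homWeight_ne_zero h'
  have h1 := hc.mem_target_of_le hq (hI.min_mem hp (hc.mem_source hq)) fun l => min_le_right _ _
  set s : Rn n := fun l => max (translate ε p l) (r l) with hs
  have hs' : translate ε s =
      fun l => max (translate ε (translate ε p) l) (translate ε r l) := funext fun l => by
    exact (max_add_add_right (translate ε p l) (r l) (ε : ℝ)).symm
  have h2 : s ∈ J.carrier := hd.mem_source_of_le hr (hs' ▸ hK.max_mem hp' (hd.mem_target hr))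
    fun l => le_max_right _ _
  exact J.ordConnected.out h1 h2
    ⟨translate_mono ε fun l => min_le_left _ _, fun l => le_max_left _ _⟩

end HomScalars

/-- Ensures that a nonzero path between long bars is visible at an actual point, so that the
identity for the composite can be evaluated there. -/
lemma exists_mem_translate_mem {I K : PInterval (Rn n)} (hI : IsRectangle I) (hK : IsRectangle K)
    {ε c : ℝ≥0} (hn : 1 ≤ n) (hc : (2 * n - 1 : ℝ) * ε < c) (hIc : Significant c I)
    (hKc : Significant c K)
    (hle : ∀ e, endpoints K e ≤ endpoints I e + ((2 * ε : ℝ) : EReal))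
    (hα : alpha (endpoints I) ≤ alpha (endpoints K)) :
    ∃ p ∈ I.carrier, translate ε (translate ε p) ∈ K.carrier := by
  have hε : (0 : ℝ) ≤ ε := ε.2
  obtain ⟨t, b, h0, hsum⟩ := endpoints_of_alpha_le (by positivity) hle hα
  have key : ∀ l, ∃ x : ℝ, lower I l < x ∧ (x + 2 * ε : ℝ) < upper K l := by
    intro l
    by_cases hbot : lower I l = ⊥
    · obtain ⟨x, -, hx⟩ := EReal.lt_iff_exists_real_btwn.1
        (bot_lt_iff_ne_bot.2 (upper_ne_bot K l))
      refine ⟨x - 2 * ε, hbot ▸ EReal.bot_lt_coe _, ?_⟩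
      simpa using hx
    by_cases htop : upper K l = ⊤
    · obtain ⟨x, hx, -⟩ := EReal.lt_iff_exists_real_btwn.1
        (lt_top_iff_ne_top.2 (lower_ne_top I l))
      exact ⟨x, hx, htop ▸ EReal.coe_lt_top _⟩
    have hbot' : lower K l ≠ ⊥ := fun h => hbot ((b (.inl l)).2 h)
    have htop' : upper I l ≠ ⊤ := fun h => htop ((t (.inr l)).1 h)
    obtain ⟨p, hp, hp'⟩ := hIc
    obtain ⟨q, hq, hq'⟩ := hKc
    have e1 := EReal.coe_toReal (lower_ne_top I l) hbot
    have e2 := EReal.coe_toReal (lower_ne_top K l) hbot'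
    have e3 := EReal.coe_toReal htop' (upper_ne_bot I l)
    have e4 := EReal.coe_toReal htop (upper_ne_bot K l)
    have i1 := lower_le hp l
    have i2 := le_upper hp' l
    have i3 := lower_le hq l
    have i4 := le_upper hq' l
    -- The total slack is at most 2n · 2ε, so the two slacks in direction `l` share that bound.
    have hpair : ((lower I l).toReal + 2 * ε - (lower K l).toReal) +
        ((upper I l).toReal + 2 * ε - (upper K l).toReal) ≤ 4 * n * ε := by
      have h := Finset.sum_le_sum_of_subset_of_nonneg
        (Finset.subset_univ ({Sum.inl l, Sum.inr l} : Finset (Fin n ⊕ Fin n)))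
        (fun e _ _ => h0 e)
      rw [Finset.sum_pair (by simp)] at h
      refine (h.trans hsum).trans (le_of_eq ?_)
      simp only [Fintype.card_sum, Fintype.card_fin]
      push_cast
      ring
    set a := (lower I l).toReal
    set a' := (lower K l).toReal
    set d := (upper I l).toReal
    set d' := (upper K l).toReal
    rw [← e1, EReal.coe_le_coe_iff] at i1
    rw [← e2, EReal.coe_le_coe_iff] at i3
    rw [← e3, EReal.coe_le_coe_iff] at i2
    rw [← e4, EReal.coe_le_coe_iff] at i4
    simp only [translate_apply] at i2 i4
    have hn' : (1 : ℝ) ≤ n := by exact_mod_cast hn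
    have hprod : 0 ≤ ((n : ℝ) - 1) * ε := mul_nonneg (by linarith) hε
    -- Both sides have length at least 2c, so the pair bound gives d' - a ≥ 2c - (2n-2)ε, which
    -- exceeds 2nε ≥ 2ε.
    have hlt : a + 2 * ε < d' := by nlinarith
    rw [← e1, ← e4]
    refine ⟨(a + (d' - 2 * ε)) / 2, ?_, ?_⟩
    · rw [EReal.coe_lt_coe_iff]
      linarith
    · rw [EReal.coe_lt_coe_iff]
      linarith
  choose x hx hx' using key
  have hxK : ∀ l, lower K l < (x l + 2 * ε : ℝ) := fun l => by
    refine (hle (.inl l)).trans_lt ?_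
    rw [EReal.coe_add]
    exact EReal.add_lt_add_right_coe (hx l) _
  have hxI : ∀ l, (x l : EReal) < upper I l := fun l => by
    have h1 := (hx' l).trans_le (hle (.inr l))
    rw [EReal.coe_add] at h1
    exact lt_of_not_ge fun h => absurd h1 (not_lt.2 (add_le_add_left h _))
  refine ⟨x, hI.mem_of_lt fun l => ⟨hx l, hxI l⟩, hK.mem_of_lt fun l => ?_⟩
  have : translate ε (translate ε (x : Rn n)) l = x l + 2 * ε := by
    change x l + (ε : ℝ) + ε = _
    ring
  rw [this]
  exact ⟨hxK l, hx' l⟩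

end Rectangles

/-! ### Interleavings of rectangle modules with close endpoints -/

section Close

variable {n : ℕ} {δ : ℝ} {c : ℝ≥0} {I J : PInterval (Rn n)}

lemma lt_add_of_close {x y : EReal} {c : ℝ} (hδ : δ < c)
    (h : (x = ⊤ ↔ y = ⊤) ∧ (x = ⊥ ↔ y = ⊥) ∧ |x.toReal - y.toReal| ≤ δ) {z : ℝ}
    (hz : x ≤ z) : y < ((z + c : ℝ) : EReal) := by
  have ht : x ≠ ⊤ := ne_top_of_le_ne_top (EReal.coe_ne_top _) hz
  by_cases hb : x = ⊥
  · rw [h.2.1.1 hb]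
    exact EReal.bot_lt_coe _
  · rw [← EReal.coe_toReal ht hb, EReal.coe_le_coe_iff] at hz
    rw [← EReal.coe_toReal (fun h' => ht (h.1.2 h')) (fun h' => hb (h.2.1.2 h')),
      EReal.coe_lt_coe_iff]
    have := abs_le.1 h.2.2
    linarith

lemma lt_of_close {x y : EReal} {c : ℝ} (hδ : δ < c)
    (h : (x = ⊤ ↔ y = ⊤) ∧ (x = ⊥ ↔ y = ⊥) ∧ |x.toReal - y.toReal| ≤ δ) {z : ℝ}
    (hz : ((z + c : ℝ) : EReal) ≤ x) : (z : EReal) < y := by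
  have hb : x ≠ ⊥ := ne_bot_of_le_ne_bot (EReal.coe_ne_bot _) hz
  by_cases ht : x = ⊤
  · rw [h.1.1 ht]
    exact EReal.coe_lt_top _
  · rw [← EReal.coe_toReal ht hb, EReal.coe_le_coe_iff] at hz
    rw [← EReal.coe_toReal (fun h' => ht (h.1.2 h')) (fun h' => hb (h.2.1.2 h')),
      EReal.coe_lt_coe_iff]
    have := abs_le.1 h.2.2
    linarith

/-- The strict inequality δ < c turns all endpoint comparisons into strict ones, so it is irrelevant
which endpoints belong to the rectangles. -/
lemma EndpointsClose.mem_of_le (hI : IsRectangle I) (hJ : IsRectangle J) (hδ : δ < c)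
    (h : EndpointsClose δ (endpoints I) (endpoints J)) {p q : Rn n} (hpq : p ≤ q)
    (hp : p ∈ I.carrier) (hq : translate c q ∈ J.carrier) :
    translate c p ∈ J.carrier ∧ q ∈ I.carrier :=
  ⟨hJ.mem_of_lower_lt (fun l => lt_add_of_close hδ (h (.inl l)) (lower_le hp l))
      (translate_mono c hpq) hq,
    hI.mem_of_lt_upper (fun l => lt_of_close hδ (h.symm (.inr l)) (le_upper hq l)) hpq hp⟩

lemma EndpointsClose.translate_mem (hJ : IsRectangle J) (hδ : δ < c)
    (h : EndpointsClose δ (endpoints I) (endpoints J)) {p : Rn n} (hp : p ∈ I.carrier)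
    (hp' : translate c (translate c p) ∈ I.carrier) : translate c p ∈ J.carrier :=
  hJ.mem_of_lt fun l => ⟨lt_add_of_close hδ (h (.inl l)) (lower_le hp l),
    lt_of_close hδ (h (.inr l)) (le_upper hp' l)⟩

variable (k : Type u) [Field k]

open Classical in
/-- The map `I p → J q` that is the identity of `k` where both spaces are `k`. -/
def crossMap (I J : PInterval (Rn n)) (p q : Rn n) :
    intervalSpace k I p →ₗ[k] intervalSpace k J q where
  toFun x := ⟨if q ∈ J.carrier then (x : k) else 0, fun h => if_neg h⟩
  map_add' x y := by
    ext
    by_cases h : q ∈ J.carrier <;> simp [h]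
  map_smul' c x := by
    ext
    by_cases h : q ∈ J.carrier <;> simp [h]

lemma EndpointsClose.crossMap_intervalMap (hI : IsRectangle I) (hJ : IsRectangle J) (hδ : δ < c)
    (h : EndpointsClose δ (endpoints I) (endpoints J)) {p q : Rn n} (hpq : p ≤ q)
    (x : intervalSpace k I p) :
    crossMap k I J q (translate c q) (intervalMap k I p q x) =
      intervalMap k J (translate c p) (translate c q) (crossMap k I J p (translate c p) x) := by
  refine Subtype.ext ?_
  by_cases hp : p ∈ I.carrier
  · by_cases hq : translate c q ∈ J.carrier
    · obtain ⟨h1, h2⟩ := h.mem_of_le hI hJ hδ hpq hp hq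
      simp [crossMap, intervalMap, hq, h1, h2]
    · simp [crossMap, intervalMap, hq]
  · simp [crossMap, intervalMap, x.2 hp]

lemma EndpointsClose.crossMap_crossMap (hJ : IsRectangle J) (hδ : δ < c)
    (h : EndpointsClose δ (endpoints I) (endpoints J)) (p : Rn n) (x : intervalSpace k I p) :
    crossMap k J I (translate c p) (translate c (translate c p))
      (crossMap k I J p (translate c p) x) =
      intervalMap k I p (translate c (translate c p)) x := by
  refine Subtype.ext ?_
  by_cases hp : p ∈ I.carrier
  · by_cases hq : translate c (translate c p) ∈ I.carrier
    · simp [crossMap, intervalMap, hq, h.translate_mem hJ hδ hp hq]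
    · simp [crossMap, intervalMap, hq]
  · simp [crossMap, intervalMap, x.2 hp]

lemma EndpointsClose.interleaved (hI : IsRectangle I) (hJ : IsRectangle J) (hδ : δ < c)
    (h : EndpointsClose δ (endpoints I) (endpoints J)) :
    Interleaved c (intervalModule k I) (intervalModule k J) :=
  interleaved_iff.2 ⟨fun p => crossMap k I J p (translate c p),
    fun p => crossMap k J I p (translate c p),
    fun _ _ hpq x => h.crossMap_intervalMap k hI hJ hδ hpq x,
    fun _ _ hpq x => h.symm.crossMap_intervalMap k hJ hI hδ hpq x,
    fun p x => h.crossMap_crossMap k hJ hδ p x,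
    fun p x => h.symm.crossMap_crossMap k hI hδ p x⟩

lemma twiceTrivial_of_not_significant (h : ¬ Significant c I) :
    TwiceTrivial c (intervalModule k I) := by
  refine fun p => ModuleCat.hom_ext (LinearMap.ext fun x => Subtype.ext ?_)
  change (intervalMap k I p (translate c (translate c p)) x : k) = 0
  by_cases hp : p ∈ I.carrier
  · have hq : translate c (translate c p) ∉ I.carrier := fun hq => h ⟨p, hp, hq⟩
    simp [intervalMap, hq]
  · simp [intervalMap, x.2 hp]

end Close

/-! ### Hall's condition -/

/-- If the product of two matrices is unitriangular for some order of the index set, the inner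
dimension is at least the outer one. -/
lemma card_le_card_of_unitriangular {k : Type*} [Field k] {ι κ L : Type*} [DecidableEq ι]
    [LinearOrder L] {A : Finset ι} {T : Finset κ} (α : ι → L) (w : ι → κ → k) (w' : κ → ι → k)
    (h : ∀ i ∈ A, ∀ i' ∈ A, α i ≤ α i' →
      ∑ j ∈ T, w i j * w' j i' = if i = i' then 1 else 0) : A.card ≤ T.card := by
  classical
  have hli : LinearIndependent k fun (i : A) (j : T) => w i j := by
    rw [Fintype.linearIndependent_iff]
    intro c hc
    by_contra! hne
    obtain ⟨i₀, hi₀⟩ := hne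
    -- In a linear relation, pair with the column of an index of maximal `α` among those with
    -- nonzero coefficient: only the diagonal term survives.
    obtain ⟨i, hi, hmax⟩ := Finset.exists_max_image (Finset.univ.filter fun i => c i ≠ 0)
      (fun i : A => α i) ⟨i₀, by simpa using hi₀⟩
    simp only [Finset.mem_filter, Finset.mem_univ, true_and] at hi hmax
    refine hi ?_
    have h1 : ∑ j : T, (∑ i' : A, c i' * w i' j) * w' j i = 0 := by
      refine Finset.sum_eq_zero fun j _ => ?_
      have := congrFun hc j
      simp only [Finset.sum_apply, Pi.smul_apply, smul_eq_mul, Pi.zero_apply] at this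
      rw [this, zero_mul]
    simp_rw [Finset.sum_mul] at h1
    rw [Finset.sum_comm] at h1
    have h2 : ∀ i' : A, ∑ j : T, c i' * w i' j * w' j i = if i' = i then c i else 0 := by
      intro i'
      by_cases hc' : c i' = 0
      · have : i' = i → c i = 0 := fun e => e ▸ hc'
        by_cases e : i' = i
        · simp [hc', this e]
        · simp [hc', e]
      · have := h i' i'.2 i i.2 (hmax i' hc')
        simp_rw [mul_assoc]
        rw [← Finset.mul_sum, Finset.sum_coe_sort T fun j => w i' j * w' j i, this]
        by_cases e : i' = i
        · simp [e]
        · have e' : (i' : ι) ≠ i := fun h => e (Subtype.ext h)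
          simp [e, e']
    simp_rw [h2] at h1
    simpa using h1
  simpa using hli.fintype_card_le_finrank

section Hall

variable {k : Type u} [Field k] {n : ℕ} {ι κ : Type v} {ε c : ℝ≥0} {B : ι → PInterval (Rn n)}
  {C : κ → PInterval (Rn n)} {a : ι → κ → Rn n → k} {b : κ → ι → Rn n → k}

/-- Either `alpha` does not decrease from `I` to `J`, or `J` lies below `I` and hence below `K`, so
that it does not decrease from `J` to `K`. -/
lemma endpointsClose_or_of_homWeight_ne_zero (hn : 1 ≤ n) {I J K : PInterval (Rn n)}
    (hI : IsRectangle I) (hJ : IsRectangle J) (hK : IsRectangle K) {f g : Rn n → k}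
    (hf : IsHomScalar (translate ε) I.carrier J.carrier f)
    (hg : IsHomScalar (translate ε) J.carrier K.carrier g)
    (hf0 : homWeight f ≠ 0) (hg0 : homWeight g ≠ 0)
    (hα : alpha (endpoints I) ≤ alpha (endpoints K)) :
    EndpointsClose ((2 * n - 1) * ε) (endpoints I) (endpoints J) ∨
      EndpointsClose ((2 * n - 1) * ε) (endpoints K) (endpoints J) := by
  have hcard : 2 ≤ Fintype.card (Fin n ⊕ Fin n) := by
    simp only [Fintype.card_sum, Fintype.card_fin]
    omega
  have hcard' : ((Fintype.card (Fin n ⊕ Fin n) : ℝ) - 1) = 2 * n - 1 := by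
    simp only [Fintype.card_sum, Fintype.card_fin]
    push_cast
    ring
  rw [← hcard']
  rcases le_total (alpha (endpoints I)) (alpha (endpoints J)) with h | h
  · exact Or.inl (endpointsClose_of_alpha_le ε.2 hcard (hf.endpoints_le hI hJ hf0) h)
  · exact Or.inr (endpointsClose_of_alpha_le ε.2 hcard (hg.endpoints_le hJ hK hg0)
      (h.trans hα)).symm

lemma IsScalarPair.sum_homWeight_mul [DecidableEq ι] (h : IsScalarPair (translate ε) B C a b)
    (hB : ∀ i, IsRectangle (B i)) (hC : ∀ j, IsRectangle (C j)) {i i' : ι} {p : Rn n}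
    (hp : p ∈ (B i).carrier) (hp' : translate ε (translate ε p) ∈ (B i').carrier)
    {T : Finset κ} (hT : ∀ j, homWeight (a i j) ≠ 0 → homWeight (b j i') ≠ 0 → j ∈ T) :
    ∑ j ∈ T, homWeight (a i j) * homWeight (b j i') = if i = i' then 1 else 0 := by
  classical
  -- If both weights are nonzero, the middle point lies in `C j` and the scalars there are the
  -- weights; otherwise both products vanish.
  have hterm : ∀ j, a i j p * b j i' (translate ε p) = homWeight (a i j) * homWeight (b j i') := by
    intro j
    by_cases h1 : homWeight (a i j) = 0
    · rw [h1, (h.left i j).eq_zero_of_homWeight (hB i) h1, zero_mul, zero_mul]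
    by_cases h2 : homWeight (b j i') = 0
    · rw [h2, (h.right j i').eq_zero_of_homWeight (hC j) h2, mul_zero, mul_zero]
    have hm := translate_mem_of_homWeight_ne_zero (hB i) (hB i') (h.left i j) (h.right j i') h1 h2
      hp hp'
    rw [(h.left i j).eq_homWeight (hB i) hp hm, (h.right j i').eq_homWeight (hC j) hm hp']
  have hsub : ∑ j ∈ T, homWeight (a i j) * homWeight (b j i') =
      ∑ j ∈ T ∪ (h.finite_left i p).toFinset, a i j p * b j i' (translate ε p) := by
    simp_rw [hterm]
    refine Finset.sum_subset Finset.subset_union_left fun j _ hj => ?_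
    by_contra hne
    exact hj (hT j (left_ne_zero_of_mul hne) (right_ne_zero_of_mul hne))
  have hsupp : ∀ j, a i j p ≠ 0 → j ∈ T ∪ (h.finite_left i p).toFinset := fun j hj =>
    Finset.mem_union_right _ ((h.finite_left i p).mem_toFinset.2 hj)
  rw [hsub]
  split_ifs with e
  · subst e
    exact h.comp_self hp hp' hsupp
  · exact h.comp_of_ne e hp hp' hsupp

lemma lt_of_mul_lt (hn : 1 ≤ n) (hc : (2 * n - 1 : ℝ) * ε < c) : (ε : ℝ) < c := by
  have hn' : (1 : ℝ) ≤ n := by exact_mod_cast hn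
  have hε : (0 : ℝ) ≤ ε := ε.2
  nlinarith

/-- The room 2(c - ε) in every coordinate contains a rational; countably many test points thus serve
all long bars. -/
lemma Significant.exists_rat {I : PInterval (Rn n)} (h : Significant c I) (hε : (ε : ℝ) < c) :
    ∃ r : Fin n → ℚ, (fun l => (r l : ℝ) : Rn n) ∈ I.carrier ∧
      translate ε (translate ε (fun l => (r l : ℝ) : Rn n)) ∈ I.carrier := by
  obtain ⟨p, hp, hp'⟩ := h
  have : ∀ l, ∃ r : ℚ, p l < r ∧ (r : ℝ) < p l + 2 * (c - ε) := fun l =>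
    exists_rat_btwn (by linarith)
  choose r hr hr' using this
  have h0 : (0 : ℝ) ≤ ε := ε.2
  refine ⟨r, I.ordConnected.out hp hp' ⟨fun l => (hr l).le, fun l => ?_⟩,
    I.ordConnected.out hp hp' ⟨fun l => ?_, fun l => ?_⟩⟩
  · have := hr' l
    change (r l : ℝ) ≤ p l + c + c
    linarith
  · have := hr l
    change p l ≤ (r l : ℝ) + ε + ε
    linarith
  · have := hr' l
    change (r l : ℝ) + ε + ε ≤ p l + c + c
    linarith

/-- Hall's condition: `T` contains every middle bar of a nonzero path along which `alpha` does not
decrease, so the weights restricted to `T` satisfy the unitriangular relations. -/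
lemma IsScalarPair.card_le_card (h : IsScalarPair (translate ε) B C a b) (hn : 1 ≤ n)
    (hB : ∀ i, IsRectangle (B i)) (hC : ∀ j, IsRectangle (C j)) (hc : (2 * n - 1 : ℝ) * ε < c)
    {A : Finset ι} (hA : ∀ i ∈ A, Significant c (B i)) {T : Finset κ}
    (hT : ∀ i ∈ A, ∀ j,
      EndpointsClose ((2 * n - 1) * ε) (endpoints (B i)) (endpoints (C j)) → j ∈ T) :
    A.card ≤ T.card := by
  classical
  refine card_le_card_of_unitriangular (fun i => alpha (endpoints (B i)))
    (fun i j => homWeight (a i j)) (fun j i => homWeight (b j i)) fun i hi i' hi' hα => ?_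
  have hmem : ∀ j, homWeight (a i j) ≠ 0 → homWeight (b j i') ≠ 0 → j ∈ T := fun j h1 h2 =>
    (endpointsClose_or_of_homWeight_ne_zero hn (hB i) (hC j) (hB i') (h.left i j) (h.right j i')
      h1 h2 hα).elim (hT i hi j) (hT i' hi' j)
  by_cases hex : ∃ p ∈ (B i).carrier, translate ε (translate ε p) ∈ (B i').carrier
  · obtain ⟨p, hp, hp'⟩ := hex
    exact h.sum_homWeight_mul hB hC hp hp' hmem
  -- With no common test point the composite gives no information, but then each product of weights
  -- is already zero.
  · have hne : i ≠ i' := by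
      rintro rfl
      obtain ⟨r, hr, hr'⟩ := (hA i hi).exists_rat (lt_of_mul_lt hn hc)
      exact hex ⟨_, hr, hr'⟩
    rw [if_neg hne]
    refine Finset.sum_eq_zero fun j _ => ?_
    by_contra h0
    refine hex (exists_mem_translate_mem (hB i) (hB i') hn hc (hA i hi) (hA i' hi') (fun e => ?_) hα)
    have h1 := (h.left i j).endpoints_le (hB i) (hC j) (left_ne_zero_of_mul h0) e
    have h2 := (h.right j i').endpoints_le (hC j) (hB i') (right_ne_zero_of_mul h0) e
    refine (h2.trans (add_le_add_left h1 _)).trans_eq ?_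
    rw [add_assoc, ← EReal.coe_add, two_mul]

lemma IsScalarPair.exists_homWeight_ne_zero (h : IsScalarPair (translate ε) B C a b)
    (hB : ∀ i, IsRectangle (B i)) (hC : ∀ j, IsRectangle (C j)) (hε : (ε : ℝ) < c) {i : ι}
    (hi : Significant c (B i)) : ∃ j, homWeight (a i j) ≠ 0 ∧ homWeight (b j i) ≠ 0 := by
  classical
  by_contra hne
  obtain ⟨r, hr, hr'⟩ := hi.exists_rat hε
  have := h.sum_homWeight_mul hB hC hr hr' (T := ∅) fun j h1 h2 => absurd ⟨j, h1, h2⟩ hne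
  simp at this

/-- Each such `i` is detected at a rational point, and at each of these only finitely many scalars
out of `j` are nonzero. -/
lemma IsScalarPair.countable_homWeight_ne_zero (h : IsScalarPair (translate ε) B C a b)
    (hB : ∀ i, IsRectangle (B i)) (hC : ∀ j, IsRectangle (C j)) (hε : (ε : ℝ) < c) (j : κ) :
    {i | Significant c (B i) ∧ homWeight (a i j) ≠ 0 ∧ homWeight (b j i) ≠ 0}.Countable := by
  refine (Set.countable_iUnion fun r : Fin n → ℚ =>
    (h.finite_right j (translate ε (fun l => (r l : ℝ) : Rn n))).countable).mono ?_
  rintro i ⟨hi, h1, h2⟩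
  obtain ⟨r, hr, hr'⟩ := hi.exists_rat hε
  refine Set.mem_iUnion.2 ⟨r, ?_⟩
  have hm := translate_mem_of_homWeight_ne_zero (hB i) (hB i) (h.left i j) (h.right j i) h1 h2 hr hr'
  exact fun h0 => h2 (((h.right j i).eq_homWeight (hC j) hm hr').symm.trans h0)

/-- Significant bars of `B` can be matched injectively with bars of `C` with close endpoints. -/
lemma IsScalarPair.exists_injective (h : IsScalarPair (translate ε) B C a b) (hn : 1 ≤ n)
    (hB : ∀ i, IsRectangle (B i)) (hC : ∀ j, IsRectangle (C j)) (hc : (2 * n - 1 : ℝ) * ε < c)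
    {η : ℝ} (hη : 0 < η) :
    ∃ f : {i | Significant c (B i)} → κ, Function.Injective f ∧
      ∀ i : {i | Significant c (B i)},
        EndpointsClose ((2 * n - 1) * ε + 3 * η) (endpoints (B i)) (endpoints (C (f i))) := by
  have hεc := lt_of_mul_lt hn hc
  have hδ : 0 ≤ (2 * n - 1 : ℝ) * ε := by
    have hn' : (1 : ℝ) ≤ n := by exact_mod_cast hn
    exact mul_nonneg (by linarith) ε.2
  choose m hm hm' using fun i : {i | Significant c (B i)} =>
    h.exists_homWeight_ne_zero hB hC hεc i.2
  have hall : ∀ (A : Finset {i | Significant c (B i)}) (T : Finset κ),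
      (∀ i ∈ A, ∀ j, KeysClose (⌈(2 * n - 1 : ℝ) * ε / η⌉₊ + 1)
        (roundedKey η (endpoints (B i))) (roundedKey η (endpoints (C j))) → j ∈ T) →
      A.card ≤ T.card := by
    intro A T hT
    rw [← Finset.card_map (Function.Embedding.subtype _)]
    refine h.card_le_card hn hB hC hc (fun i hi => ?_) fun i hi j hij => ?_
    · obtain ⟨i', -, rfl⟩ := Finset.mem_map.1 hi
      exact i'.2
    · obtain ⟨i', hi', rfl⟩ := Finset.mem_map.1 hi
      exact hT i' hi' j (hij.keysClose hη)
  obtain ⟨f, hf, hfE⟩ := exists_injective_of_locallyFinite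
    (fun i : {i | Significant c (B i)} => roundedKey η (endpoints (B i)))
    (fun j => roundedKey η (endpoints (C j)))
    (KeysClose (⌈(2 * n - 1 : ℝ) * ε / η⌉₊ + 1)) (finite_keysClose _) hall m
    -- A path from a bar back to itself: both alternatives state closeness to the same bar.
    (fun i => EndpointsClose.keysClose hη
      ((endpointsClose_or_of_homWeight_ne_zero hn (hB i) (hC _) (hB i) (h.left i _)
        (h.right _ i) (hm i) (hm' i) le_rfl).elim id id))
    (fun j => ((h.countable_homWeight_ne_zero hB hC hεc j).preimage Subtype.val_injective).mono
      (by
        rintro i rfl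
        exact ⟨i.2, hm i, hm' i⟩))
  exact ⟨f, hf, fun i => (hfE i).endpointsClose hδ hη⟩

end Hall

/-! ### Stability -/

section Stability

variable {k : Type u} [Field k] {n : ℕ} {M N : PersistenceModule.{u, v} k (Rn n)} {ε : ℝ≥0}

lemma Interleaved.matched (hn : 1 ≤ n) (hM : RectangleDecomposable M)
    (hN : RectangleDecomposable N) (h : Interleaved ε M N) {η : ℝ≥0} (hη : 0 < η) :
    Matched ((2 * n - 1 : ℕ) * ε + 4 * η) M N := by
  refine ⟨?_, ?_, fun ι κ B C hB hC => ?_⟩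
  · obtain ⟨ι, B, hB, -⟩ := hM
    exact ⟨ι, B, hB⟩
  · obtain ⟨κ, C, hC, -⟩ := hN
    exact ⟨κ, C, hC⟩
  -- Rounding uses 3η; the fourth η gives the strict inequality required for interleaving the
  -- rectangles.
  set c : ℝ≥0 := (2 * n - 1 : ℕ) * ε + 4 * η with hc
  have hη' : (0 : ℝ) < η := hη
  have hcoe : (c : ℝ) = (2 * n - 1 : ℝ) * ε + 4 * η := by
    have hcast : ((2 * n - 1 : ℕ) : ℝ) = 2 * n - 1 := by
      rw [Nat.cast_sub (by omega)]
      push_cast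
      ring
    rw [hc, NNReal.coe_add, NNReal.coe_mul, NNReal.coe_mul, NNReal.coe_natCast, hcast]
    norm_num
  have hlt : (2 * n - 1 : ℝ) * ε + 3 * η < c := by
    rw [hcoe]
    linarith
  have hlt' : (2 * n - 1 : ℝ) * ε < c := by
    rw [hcoe]
    linarith
  have hBR := hM.isRectangle hB
  have hCR := hN.isRectangle hC
  obtain ⟨a, b, hab⟩ := h.exists_isScalarPair hB hC
  obtain ⟨a', b', hab'⟩ := h.symm.exists_isScalarPair hC hB
  obtain ⟨f, hf, hfR⟩ := hab.exists_injective hn hBR hCR hlt' hη'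
  obtain ⟨g, hg, hgR⟩ := hab'.exists_injective hn hCR hBR hlt' hη'
  obtain ⟨σ, h1, h2, h3⟩ := exists_pequiv_of_injective
    (R := fun i j => EndpointsClose ((2 * n - 1) * ε + 3 * η) (endpoints (B i)) (endpoints (C j)))
    hf hg hfR fun j => (hgR j).symm
  refine ⟨σ, fun i hi => ?_, fun j hj => ?_, fun i j hij => ?_⟩
  · exact twiceTrivial_of_not_significant k fun hs => h1 i hs hi
  · exact twiceTrivial_of_not_significant k fun hs => h2 j hs hj
  · exact (h3 i j hij).interleaved k (hBR i) (hCR j) hlt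

theorem bottleneckDist_le_mul_interleavingDist (hn : 1 ≤ n) (hM : RectangleDecomposable M)
    (hN : RectangleDecomposable N) :
    bottleneckDist M N ≤ ((2 * n - 1 : ℕ) : ℝ≥0∞) * interleavingDist M N := by
  have key : ∀ ε : ℝ≥0, Interleaved ε M N →
      bottleneckDist M N ≤ ((2 * n - 1 : ℕ) : ℝ≥0∞) * ε := by
    intro ε h
    refine ENNReal.le_of_forall_pos_le_add fun η hη _ => ?_
    have hη4 : 0 < η / 4 := by positivity
    have hle : bottleneckDist M N ≤ (((2 * n - 1 : ℕ) * ε + 4 * (η / 4) : ℝ≥0) : ℝ≥0∞) :=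
      iInf₂_le (f := fun (δ : ℝ≥0) (_ : Matched δ M N) => (δ : ℝ≥0∞)) _ (h.matched hn hM hN hη4)
    refine hle.trans_eq ?_
    rw [mul_div_cancel₀ η (by norm_num : (4 : ℝ≥0) ≠ 0)]
    push_cast
    rfl
  have h0 : ((2 * n - 1 : ℕ) : ℝ≥0∞) ≠ 0 := by
    rw [Ne, Nat.cast_eq_zero]
    omega
  -- The factor is nonzero and finite, so it can be moved across and the infimum bounded termwise,
  -- also when no interleaving exists.
  rw [mul_comm, ← ENNReal.div_le_iff h0 (ENNReal.natCast_ne_top _)]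
  refine le_iInf₂ fun ε h => ?_
  rw [ENNReal.div_le_iff h0 (ENNReal.natCast_ne_top _), mul_comm]
  exact key ε h

end Stability

end

end Persistence

theorem corollary5p3 (k : Type u) [Field k] :
    (∀ (n : ℕ), 1 ≤ n → ∀ M N : Persistence.PersistenceModule.{u, v} k (Persistence.Rn n),
      Persistence.RectangleDecomposable M → Persistence.RectangleDecomposable N →
        Persistence.bottleneckDist M N ≤
          ((2 * n - 1 : ℕ) : ENNReal) * Persistence.interleavingDist M N) ∧
    (∀ M N : Persistence.PersistenceModule.{u, v} k (Persistence.Rn 1),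
      Persistence.IntervalDecomposable M → Persistence.IntervalDecomposable N →
        Persistence.bottleneckDist M N = Persistence.interleavingDist M N) := by
  refine ⟨fun n hn M N hM hN =>
    Persistence.bottleneckDist_le_mul_interleavingDist hn hM hN, fun M N hM hN => le_antisymm ?_
      (Persistence.interleavingDist_le_bottleneckDist M N)⟩
  obtain ⟨ι, B, hB⟩ := hM
  obtain ⟨κ, C, hC⟩ := hN
  simpa using Persistence.bottleneckDist_le_mul_interleavingDist le_rfl
    ⟨ι, B, hB, fun i => Persistence.isRectangle_of_dim_one (B i)⟩
    ⟨κ, C, hC, fun j => Persistence.isRectangle_of_dim_one (C j)⟩
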